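/- **Quantum Simulation Theorem.** *Model.* A quantum network has a finite set of processors and a capacity $B_{uv}\in\{0,1,\dots,\infty\}$ for each ordered pair $u\ne v$. A protocol with entanglement gives every processor $v$ a finite-dimensional workspace, which contains a register holding its input $x_v$; the remaining parts of the workspaces start in an arbitrary joint unit vector that does not depend on the input. In each round every processor first applies a unitary to its workspace and its incoming channels, after which all channels must be clear (in the state $|0\rangle$), and then a message of $B_{uv}$ qubits (arbitrarily many if $B_{uv}=\infty$) prepared by $u$ is moved into the channel from $u$ to $v$, for all $u\neq v$. After $T$ rounds each processor measures its workspace in the computational basis and outputs a bit determined by the outcome. The protocol solves a boolean (promise) problem with $(\epsilon_0,\epsilon_1)$-error if on every $i$-input every processor outputs $i$ with probability at least $1-\epsilon_i$ ($i\in\{0,1\}$). $Q^{*}_{\epsilon_0,\epsilon_1}$ denotes the least number of rounds $T$ (it is $\infty$ if there is none). In the *$B$-model* on a graph $N$, the processors are the vertices of $N$ and the capacity is $B$ in both directions along every edge and $0$ otherwise; we write $Q^{*,N}$. In the *server model* there are three processors, Carol, David and the server; Carol and David have capacity $1$ to each other and to the server, and the server has capacity $\infty$ to both; we write $Q^{*,sv}$.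 *Problems.* In $\mathsf{Ham}(N)$ the input is a subgraph $M$ of $N$ on the same vertices (each vertex knows which of its edges are in $M$), and one asks whether $M$ is a Hamiltonian cycle, i.e. a simple cycle through all vertices with no further edges. For a property $\mathcal P$ and real $\delta\ge 0$, $M$ is $\delta$-far from $\mathcal P$ in $N$ if every subgraph $M'$ of $N$ on the same vertices with property $\mathcal P$ has at least $\delta$ edges outside $M$. In $\delta$-$\mathsf{Ham}(N)$ (resp. $\delta$-$\mathsf{Conn}(N)$) the $1$-inputs are the $M$ that are Hamiltonian cycles (resp. connected, spanning all vertices), and the $0$-inputs are the $M$ that are not but are $\delta$-far from it. In the server-model problems $\mathsf{Ham}_\Gamma$, $\delta$-$\mathsf{Ham}_\Gamma$, $\delta$-$\mathsf{Conn}_\Gamma$, Carol and David receive disjoint edge sets $E_C,E_D$ on $\Gamma$ common vertices, the server receives nothing, and the same questions are asked about $G=E_C\cup E_D$, where $\delta$-far refers to adding arbitrary edges (that is, $N$ is replaced by the complete graph); for the two $\mathsf{Ham}$ problems $E_C$ and $E_D$ are promised to be perfect matchings. *Theorem.* There are absolute constants $c_1,c_2,C>0$ such that for all integers $B\ge 1$,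 $L\ge 2$, $\Gamma\ge\log_2 L$ and all reals $\beta\ge 0$, $\epsilon_0,\epsilon_1\ge 0$ there is a connected graph $N$ whose number $n$ of vertices and diameter $D$ satisfy $c_1\Gamma L\le n\le c_2\Gamma L$ and $c_1\log_2 L\le D\le c_2\log_2 L$, such that for each pair $$(P,P')\in\{((\beta\Gamma)\text{-}\mathsf{Ham}(N),(\beta\Gamma)\text{-}\mathsf{Ham}_\Gamma),\ (\mathsf{Ham}(N),\mathsf{Ham}_\Gamma),\ ((\beta\Gamma)\text{-}\mathsf{Conn}(N),(\beta\Gamma)\text{-}\mathsf{Conn}_\Gamma)\}$$ the following holds: if $Q^{*,N}_{\epsilon_0,\epsilon_1}(P)\le \frac L2-2$, then $$Q^{*,sv}_{\epsilon_0,\epsilon_1}(P')\le C\,(B\log_2 L)\,Q^{*,N}_{\epsilon_0,\epsilon_1}(P).$$ -/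

import Mathlib

/-! ### Quantum networks with bandwidth parameters -/

/-- The number of qubits of a channel of capacity `c`; a channel of infinite capacity carries `K`
qubits, where `K` is an arbitrary number chosen by the protocol. -/
noncomputable def numQubits (K : ℕ) (c : ℕ∞) : ℕ :=
  open scoped Classical in if c = ⊤ then K else c.toNat

/-- The computational basis of a channel of capacity `c`: bit strings. -/
abbrev Msg (K : ℕ) (c : ℕ∞) : Type := Fin (numQubits K c) → Bool

/-- The all-zero string, i.e. the basis state of a clear channel. -/
def clearMsg (K : ℕ) (c : ℕ∞) : Msg K c := fun _ => false

/-- The computational basis of everything processor `v` acts on: its workspace (basis `W v`), its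
outboxes (the part of its workspace where it prepares the message to each `u`), and the incoming
channels (from each `u` to `v`).  The capacities `cap v v` are `0` in the networks below: what a
processor keeps for itself is in its workspace. -/
abbrev LocalBasis {V : Type} (cap : V → V → ℕ∞) (K : ℕ) (W : V → Type) (v : V) : Type :=
  W v × ((u : V) → Msg K (cap v u)) × ((u : V) → Msg K (cap u v))

/-- The computational basis of the whole network.  Every register belongs to exactly one
`LocalBasis`, so the network's Hilbert space is the tensor product over all `v`; a (pure) network
state is a vector `GlobalBasis cap K W → ℂ`. -/
abbrev GlobalBasis {V : Type} (cap : V → V → ℕ∞) (K : ℕ) (W : V → Type) : Type :=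
  (v : V) → LocalBasis cap K W v

/-- One round of communication on basis states: the outbox of `v` for `u` is swapped with the
channel from `v` to `u`, for all `v` and `u` simultaneously. -/
def exchange {V : Type} {cap : V → V → ℕ∞} {K : ℕ} {W : V → Type}
    (c : GlobalBasis cap K W) : GlobalBasis cap K W :=
  fun v => ((c v).1, fun u => (c u).2.2 v, fun u => (c u).2.1 v)

/-- A quantum protocol with prior entanglement on processors `V` with bandwidth `cap`, where each
processor receives an input in `X`.  The workspace of `v` has the basis `X × Anc v`: an input
register, and further qubits of arbitrary finite dimension. -/
structure QProtocol (V : Type) [Fintype V] [DecidableEq V] (cap : V → V → ℕ∞)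
    (X : Type) [Fintype X] [DecidableEq X] where
  /-- number of qubits of a channel of infinite capacity -/
  K : ℕ
  /-- basis of the workspace of each processor, apart from its input register -/
  Anc : V → Type
  /-- workspaces are finite-dimensional -/
  [fintypeAnc : ∀ v, Fintype (Anc v)]
  /-- basis states can be compared (no restriction, classically) -/
  [decEqAnc : ∀ v, DecidableEq (Anc v)]
  /-- amplitudes of the shared initial state of the workspaces; it is an arbitrary multipartite
  state which does not depend on the input -/
  ent : ((v : V) → Anc v) → ℂ
  /-- the shared state is a unit vector -/
  ent_unit : ∑ w, ‖ent w‖ ^ 2 = 1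
  /-- the internal computation of processor `v` in round `t` -/
  step : (t : ℕ) → (v : V) →
    Matrix (LocalBasis cap K (fun u => X × Anc u) v) (LocalBasis cap K (fun u => X × Anc u) v) ℂ
  /-- internal computations are unitary -/
  step_unitary : ∀ t v, step t v ∈ Matrix.unitaryGroup _ ℂ
  /-- the answer of `v`, as a function of the outcome of measuring its workspace in the
  computational basis -/
  answer : (v : V) → X × Anc v → Bool

attribute [instance] QProtocol.fintypeAnc QProtocol.decEqAnc

namespace QProtocol

variable {V : Type} [Fintype V] [DecidableEq V] {cap : V → V → ℕ∞} {X : Type} [Fintype X]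
  [DecidableEq X]

/-- The computational basis of the network on which the protocol runs. -/
abbrev Basis (A : QProtocol V cap X) : Type := GlobalBasis cap A.K (fun u => X × A.Anc u)

/-- The initial state on input `x`: the input registers hold `x`, the other parts of the
workspaces share the entangled state, and all outboxes and channels are clear. -/
noncomputable def init (A : QProtocol V cap X) (x : V → X) : A.Basis → ℂ := fun c =>
  if (∀ v, (c v).1.1 = x v) ∧
      ∀ v u, (c v).2.1 u = clearMsg A.K (cap v u) ∧ (c v).2.2 u = clearMsg A.K (cap u v)
  then A.ent (fun v => (c v).1.2) else 0

/-- The internal computations of round `t`: the tensor product of the unitaries `A.step t v`. -/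
noncomputable def compute (A : QProtocol V cap X) (t : ℕ) (ψ : A.Basis → ℂ) : A.Basis → ℂ :=
  fun c => ∑ c' : A.Basis, (∏ v, A.step t v (c v) (c' v)) * ψ c'

/-- The network state after `t` rounds, each consisting of internal computation and
communication. -/
noncomputable def run (A : QProtocol V cap X) (x : V → X) : ℕ → A.Basis → ℂ
  | 0 => A.init x
  | t + 1 => fun c => A.compute t (A.run x t) (exchange c)

/-- Measuring any channel in the computational basis gives zero with probability one. -/
def IsClear (A : QProtocol V cap X) (ψ : A.Basis → ℂ) : Prop :=
  ∀ c, ψ c ≠ 0 → ∀ v u, (c v).2.2 u = clearMsg A.K (cap u v)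

/-- The probability that processor `v` outputs `b` after `T` rounds on input `x`. -/
noncomputable def outputProb (A : QProtocol V cap X) (x : V → X) (T : ℕ) (v : V) (b : Bool) : ℝ :=
  ∑ c : A.Basis, if A.answer v (c v).1 = b then ‖A.run x T c‖ ^ 2 else 0

end QProtocol

/-- A boolean problem with a promise: the inputs with answer `1` and those with answer `0`. -/
structure PromiseProblem (V X : Type) where
  /-- the `1`-inputs -/
  isOne : (V → X) → Prop
  /-- the `0`-inputs -/
  isZero : (V → X) → Prop

/-- `A` solves `P` in `T` rounds with `(ε₀, ε₁)`-error: on every input of `P`, the channels are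
clear after each internal computation, and every processor outputs the right answer with
probability at least `1 - ε₀` on `0`-inputs and at least `1 - ε₁` on `1`-inputs. -/
def QProtocol.Computes {V : Type} [Fintype V] [DecidableEq V] {cap : V → V → ℕ∞} {X : Type}
    [Fintype X] [DecidableEq X] (A : QProtocol V cap X) (P : PromiseProblem V X) (ε₀ ε₁ : ℝ) (T : ℕ) : Prop :=
  ∀ x : V → X, P.isOne x ∨ P.isZero x →
    (∀ t < T, A.IsClear (A.compute t (A.run x t))) ∧
    (∀ v, P.isZero x → 1 - ε₀ ≤ A.outputProb x T v false) ∧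
    (∀ v, P.isOne x → 1 - ε₁ ≤ A.outputProb x T v true)

/-- The `(ε₀, ε₁)`-error quantum time complexity with entanglement of `P` on the network with
bandwidth `cap`: the least number of rounds (`⊤` if `P` cannot be solved). -/
noncomputable def quantumComplexity {V : Type} [Fintype V] [DecidableEq V] (cap : V → V → ℕ∞)
    {X : Type} [Fintype X] [DecidableEq X] (P : PromiseProblem V X) (ε₀ ε₁ : ℝ) : ℕ∞ :=
  ⨅ (T : ℕ) (_ : ∃ A : QProtocol V cap X, A.Computes P ε₀ ε₁ T), (T : ℕ∞)

/-! ### The two models -/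

/-- The `B`-model on the graph `N`: `B` qubits per round through each edge in each direction. -/
noncomputable def bModel {V : Type} (N : SimpleGraph V) (B : ℕ) (u v : V) : ℕ∞ :=
  open scoped Classical in if N.Adj u v then (B : ℕ∞) else 0

/-- The three parties of the server model. -/
inductive Party where
  | carol | david | server
  deriving DecidableEq

instance : Fintype Party :=
  ⟨{Party.carol, Party.david, Party.server}, fun p => by cases p <;> simp⟩

/-- The server model: in each round Carol and David send one qubit to each other and to the
server, and the server sends messages of unbounded size. -/
def serverModel : Party → Party → ℕ∞
  | .server, .carol => ⊤
  | .server, .david => ⊤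
  | .carol, .david => 1
  | .carol, .server => 1
  | .david, .carol => 1
  | .david, .server => 1
  | _, _ => 0

/-! ### Graph properties and their gap versions -/

/-- The graph `G` is a Hamiltonian cycle: a simple cycle through all vertices, without any other
edge. -/
def IsHamCycle {V : Type} [DecidableEq V] (G : SimpleGraph V) : Prop :=
  ∃ (a : V) (p : G.Walk a a), p.IsHamiltonianCycle ∧ ∀ e ∈ G.edgeSet, e ∈ p.edges

/-- `G` is `δ`-far from `P` inside `host`: to turn `G` into a subgraph of `host` with property `P`
by adding edges of `host` and removing any number of edges, one has to add at least `δ` edges. -/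
def IsFar {V : Type} (host : SimpleGraph V) (P : SimpleGraph V → Prop) (δ : ℝ)
    (G : SimpleGraph V) : Prop :=
  ∀ G' ≤ host, P G' → δ ≤ ((G'.edgeSet \ G.edgeSet).ncard : ℝ)

/-- The input of node `v` in a verification problem: which edges at `v` are in `M`. -/
noncomputable def nodeInput {V : Type} (M : SimpleGraph V) (v : V) : V → Bool :=
  fun u => open scoped Classical in decide (M.Adj v u)

/-- The distributed verification problem on the network `N` whose `1`-inputs (`0`-inputs) are the
subnetworks of `N` satisfying `one` (`zero`). -/
def networkProblem {V : Type} (N : SimpleGraph V) (one zero : SimpleGraph V → Prop) :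
    PromiseProblem V (V → Bool) where
  isOne x := ∃ M ≤ N, x = nodeInput M ∧ one M
  isZero x := ∃ M ≤ N, x = nodeInput M ∧ zero M

/-- `δ-P(N)`: does the subnetwork `M` satisfy `P`, or is it `δ`-far from `P` in `N`?  (For `δ > 0`
a graph that is `δ`-far from `P` never satisfies `P`; for `δ = 0` this is the problem `P(N)`.) -/
def gapNetworkProblem {V : Type} (N : SimpleGraph V) (P : SimpleGraph V → Prop) (δ : ℝ) :
    PromiseProblem V (V → Bool) :=
  networkProblem N P (fun M => ¬ P M ∧ IsFar N P δ M)

noncomputable instance instDecEqGraphFin (n : ℕ) : DecidableEq (SimpleGraph (Fin n)) :=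
  Classical.decEq _

/-- The inputs of the parties: Carol gets `EC`, David gets `ED`, and the server gets nothing
(encoded as the empty graph). -/
def partyInput {n : ℕ} (EC ED : SimpleGraph (Fin n)) : Party → SimpleGraph (Fin n)
  | .carol => EC
  | .david => ED
  | .server => ⊥

/-- The server-model problem on graphs with `n` nodes whose edges are partitioned into `EC` and
`ED`, subject to the promise `dom EC ED`. -/
def serverProblem (n : ℕ) (dom : SimpleGraph (Fin n) → SimpleGraph (Fin n) → Prop)
    (one zero : SimpleGraph (Fin n) → Prop) : PromiseProblem Party (SimpleGraph (Fin n)) where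
  isOne x := ∃ EC ED, Disjoint EC ED ∧ dom EC ED ∧ x = partyInput EC ED ∧ one (EC ⊔ ED)
  isZero x := ∃ EC ED, Disjoint EC ED ∧ dom EC ED ∧ x = partyInput EC ED ∧ zero (EC ⊔ ED)

/-- Both players hold perfect matchings (the promise of the Hamiltonian cycle problems). -/
def BothPerfectMatchings {n : ℕ} (EC ED : SimpleGraph (Fin n)) : Prop :=
  (⊤ : EC.Subgraph).IsPerfectMatching ∧ (⊤ : ED.Subgraph).IsPerfectMatching

/-- `Ham(N)`. -/
def hamNetwork {n : ℕ} (N : SimpleGraph (Fin n)) : PromiseProblem (Fin n) (Fin n → Bool) :=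
  networkProblem N IsHamCycle (fun M => ¬ IsHamCycle M)

/-- `δ-Ham(N)`. -/
def gapHamNetwork {n : ℕ} (N : SimpleGraph (Fin n)) (δ : ℝ) :
    PromiseProblem (Fin n) (Fin n → Bool) :=
  gapNetworkProblem N IsHamCycle δ

/-- `δ-Conn(N)`. -/
def gapConnNetwork {n : ℕ} (N : SimpleGraph (Fin n)) (δ : ℝ) :
    PromiseProblem (Fin n) (Fin n → Bool) :=
  gapNetworkProblem N SimpleGraph.Connected δ

/-- `Ham_n` in the server model. -/
def hamServer (n : ℕ) : PromiseProblem Party (SimpleGraph (Fin n)) :=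
  serverProblem n BothPerfectMatchings IsHamCycle (fun G => ¬ IsHamCycle G)

/-- `δ-Ham_n` in the server model; here any edges may be added. -/
def gapHamServer (n : ℕ) (δ : ℝ) : PromiseProblem Party (SimpleGraph (Fin n)) :=
  serverProblem n BothPerfectMatchings IsHamCycle (fun G => ¬ IsHamCycle G ∧ IsFar ⊤ IsHamCycle δ G)

/-- `δ-Conn_n` in the server model; the two edge sets are arbitrary. -/
def gapConnServer (n : ℕ) (δ : ℝ) : PromiseProblem Party (SimpleGraph (Fin n)) :=
  serverProblem n (fun _ _ => True) SimpleGraph.Connected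
    (fun G => ¬ G.Connected ∧ IsFar ⊤ SimpleGraph.Connected δ G)

/-- The implication between a problem `P` on the `B`-model network `N` and a server-model
problem `P'`: if the complexity of `P` is `T ≤ L / 2 - 2`, then that of `P'` is at most
`C * (B * log L) * T`. -/
def SimulationBound {n m : ℕ} (C : ℝ) (B L : ℕ) (ε₀ ε₁ : ℝ) (N : SimpleGraph (Fin n))
    (P : PromiseProblem (Fin n) (Fin n → Bool))
    (P' : PromiseProblem Party (SimpleGraph (Fin m))) : Prop :=
  ∀ T : ℕ, quantumComplexity (bModel N B) P ε₀ ε₁ = T → (T : ℝ) ≤ (L : ℝ) / 2 - 2 →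
    ∃ S : ℕ, quantumComplexity serverModel P' ε₀ ε₁ = S ∧
      (S : ℝ) ≤ C * ((B : ℝ) * Real.logb 2 L) * T

/-!
A protocol `A` on a suitable network `N` is simulated by the three parties of the server model, at
the price of `O(B log L)` rounds for each round of `A`.

**The network** (`lineNetwork`). The vertices form `Γ` lines and `2 ^ k` columns, where
`2 ^ k` is the least power of two that is at least `L`.  Every line is a path, every column is a star
around its vertex on the first line, and the first line has shortcuts from column `2 ^ i * y` to
column `2 ^ i * (y + 1)` for `y ≥ 1`.  The shortcuts make the diameter `O(log L)`, since a column
number can be reduced to `1` by halving it when it is even and decreasing it when it is odd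
(`exists_walk_length_le`).  Conversely, an edge at most doubles the column number, up to a shift by
one, so the diameter is at least `k` (`log_le_log_add_length`).  Edges that skip a given column are
shortcuts, and there is at most one of each length (`eq_of_lineNetwork_adj_of_lt`), hence at most
`k` of them.

**The reduction** (`lineSubgraph`). The first column and the last column are cliques, so that copies
of `E_C` and `E_D` fit there.  Together with the lines they form a subgraph `M` of `N` which arises
from `G = E_C ∪ E_D` by replacing vertices by paths.  Thus `M` is connected if and only if `G` is.
If `E_C` and `E_D` are disjoint perfect matchings, then `M` and `G` are 2-regular, and a 2-regular
graph is a Hamiltonian cycle if and only if it is connected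
(`isHamCycle_iff_connected_and_ncard_eq_two`).  Distances from a property are compared by counting
components: `M` has at least as many components as `G`.  To connect a graph with `c` components one
needs at least `c - 1` new edges, and `c - 1` edges suffice.  To obtain a Hamiltonian cycle from a
disconnected graph with `c` components one needs at least `c` new edges, and for disjoint cycles
`c` edges suffice, which cut and join them one after the other
(`exists_isHamCycle_ncard_sdiff_le`).

**The simulation** (`Schedule.protocol`). In round `t` Carol owns the first `t + 1` columns, David
the last `t + 1` columns, and the server the rest.  Each party performs the internal computations of
the vertices it owns.  After that, vertices and messages have to be moved to the owners in round
`t + 1`.  Only the server gives vertices away, and its channels are unbounded.  The messages that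
leave the part of Carol or David travel along edges that skip a column, so they have at most
`k * B` qubits in total, and these can be sent one by one.  The rounds in which registers are moved
permute basis states.  What a party has to do locally in such a round is given only by its view
before and its view after as functions of the simulated basis state, and a suitable permutation
exists as soon as both views have the same kernel (`exists_perm_apply_eq`).  As the initial state of
a protocol does not depend on its input, the input registers are stored up to an involution that
depends on the input (`Schedule.frame`).  While `2 * T + 4 ≤ L` the three parts remain disjoint and
nonempty, so at the end every party can announce the answer of one of its vertices.
-/

/-! ### Pushing states forward along maps of basis states -/

/-- The image of the state `ψ` under the linear map that sends the basis state `i` to `Φ i`. -/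
noncomputable def pushState {ι β : Type*} [Fintype ι] (Φ : ι → β) (ψ : ι → ℂ) :
    β → ℂ :=
  open scoped Classical in fun b => ∑ i, if Φ i = b then ψ i else 0

section pushState

variable {ι κ β γ : Type*} [Fintype ι] [Fintype κ]

theorem pushState_congr {Φ Ψ : ι → β} {ψ : ι → ℂ} (h : ∀ i, ψ i ≠ 0 → Φ i = Ψ i) :
    pushState Φ ψ = pushState Ψ ψ := by
  funext b
  refine Finset.sum_congr rfl fun i _ => ?_
  by_cases hi : ψ i = 0
  · simp [hi]
  · rw [h i hi]

theorem pushState_pushState [Fintype β] (Φ : β → γ) (Ψ : ι → β) (ψ : ι → ℂ) :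
    pushState Φ (pushState Ψ ψ) = pushState (fun i => Φ (Ψ i)) ψ := by
  classical
  funext c
  simp only [pushState]
  have : ∀ b : β, (if Φ b = c then ∑ i, (if Ψ i = b then ψ i else 0) else 0)
      = ∑ i, if Ψ i = b then (if Φ b = c then ψ i else 0) else 0 := by
    intro b
    split_ifs <;> simp
  simp_rw [this]
  rw [Finset.sum_comm]
  simp

theorem pushState_comp_equiv (Φ : ι → β) (ψ : ι → ℂ) (e : κ ≃ ι) :
    pushState (fun i => Φ (e i)) (fun i => ψ (e i)) = pushState Φ ψ := by
  classical
  funext b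
  exact Equiv.sum_comp e (fun i => if Φ i = b then ψ i else 0)

theorem exists_of_pushState_ne_zero {Φ : ι → β} {ψ : ι → ℂ} {b : β} (h : pushState Φ ψ b ≠ 0) :
    ∃ i, ψ i ≠ 0 ∧ Φ i = b := by
  obtain ⟨i, -, hi⟩ := Finset.exists_ne_zero_of_sum_ne_zero h
  by_cases hb : Φ i = b
  · exact ⟨i, by simpa [hb] using hi, hb⟩
  · simp [hb] at hi

theorem pushState_apply_of_injective {Φ : ι → β} (hΦ : Function.Injective Φ) (ψ : ι → ℂ) (i : ι) :
    pushState Φ ψ (Φ i) = ψ i := by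
  classical
  simp [pushState, hΦ.eq_iff]

/-- A weighted sum of squared amplitudes does not change under an injective relabelling of basis
states. -/
theorem sum_pushState_of_injective [Fintype β] {Φ : ι → β} (hΦ : Function.Injective Φ)
    (ψ : ι → ℂ) (p : β → Prop) [DecidablePred p] :
    (∑ b, if p b then ‖pushState Φ ψ b‖ ^ 2 else 0) =
      ∑ i, if p (Φ i) then ‖ψ i‖ ^ 2 else 0 := by
  classical
  have h : (∑ i, if p (Φ i) then ‖ψ i‖ ^ 2 else 0) = ∑ b ∈ Finset.univ.image Φ,
      if p b then ‖pushState Φ ψ b‖ ^ 2 else 0 := by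
    rw [Finset.sum_image fun i _ j _ h => hΦ h]
    simp only [pushState_apply_of_injective hΦ]
  rw [h]
  symm
  refine Finset.sum_subset (Finset.subset_univ _) fun b _ hb => ?_
  have : pushState Φ ψ b = 0 := by
    by_contra h
    obtain ⟨i, -, rfl⟩ := exists_of_pushState_ne_zero h
    exact hb (Finset.mem_image_of_mem _ (Finset.mem_univ _))
  simp [this]

end pushState

/-! ### Unitary matrices -/

/-- Two functions with the same kernel differ by a permutation of the target: a local reversible
operation can transform a family of basis states into another as soon as it neither merges nor
splits any of them. -/
theorem exists_perm_apply_eq {ι α : Type*} [Finite α] {f g : ι → α}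
    (h : ∀ i j, f i = f j ↔ g i = g j) : ∃ σ : Equiv.Perm α, ∀ i, σ (f i) = g i := by
  classical
  have hfr : ∀ y : Set.range f, ∃ i, f i = y := fun y => y.2
  choose s hs using hfr
  have key : ∀ i, g (s ⟨f i, i, rfl⟩) = g i := fun i => (h _ _).1 (hs ⟨f i, i, rfl⟩)
  let F : {x // x ∈ Set.range f} → {x // x ∈ Set.range g} := fun y => ⟨g (s y), s y, rfl⟩
  have hF : Function.Bijective F := by
    constructor
    · intro y z hyz
      have : g (s y) = g (s z) := congrArg Subtype.val hyz
      have h2 := (h _ _).2 this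
      rw [hs, hs] at h2
      exact Subtype.ext h2
    · rintro ⟨_, i, rfl⟩
      exact ⟨⟨f i, i, rfl⟩, Subtype.ext (key i)⟩
  refine ⟨(Equiv.ofBijective F hF).extendSubtype, fun i => ?_⟩
  rw [Equiv.extendSubtype_apply_of_mem _ _ (Set.mem_range_self i)]
  exact key i

/-- A permutation carrying `f` to `g`, if there is one (otherwise the identity). -/
noncomputable def transportPerm {ι α : Type*} (f g : ι → α) : Equiv.Perm α :=
  open scoped Classical in
  if h : ∃ σ : Equiv.Perm α, ∀ i, σ (f i) = g i then h.choose else 1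

theorem transportPerm_apply {ι α : Type*} [Finite α] {f g : ι → α}
    (h : ∀ i j, f i = f j ↔ g i = g j) (i : ι) : transportPerm f g (f i) = g i := by
  have h' := exists_perm_apply_eq h
  rw [transportPerm, dif_pos h']
  exact h'.choose_spec i

/-- The matrix of the linear map that permutes the basis states by `σ`. -/
def basisPerm {α : Type*} [DecidableEq α] (σ : Equiv.Perm α) : Matrix α α ℂ :=
  fun b b' => if b = σ b' then 1 else 0

theorem basisPerm_mem_unitaryGroup {α : Type*} [Fintype α] [DecidableEq α] (σ : Equiv.Perm α) :
    basisPerm σ ∈ Matrix.unitaryGroup α ℂ := by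
  rw [Matrix.mem_unitaryGroup_iff']
  ext a b
  simp [basisPerm, Matrix.mul_apply, Matrix.star_apply, Matrix.one_apply, eq_comm]

/-- The tensor product of the matrices `M v`. -/
def piMatrix {V : Type*} [Fintype V] {β : V → Type*} (M : ∀ v, Matrix (β v) (β v) ℂ) :
    Matrix (∀ v, β v) (∀ v, β v) ℂ :=
  fun c c' => ∏ v, M v (c v) (c' v)

theorem piMatrix_mem_unitaryGroup {V : Type*} [Fintype V] [DecidableEq V] {β : V → Type*}
    [∀ v, Fintype (β v)] [∀ v, DecidableEq (β v)] [DecidableEq (∀ v, β v)] {M : ∀ v, Matrix (β v) (β v) ℂ}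
    (hM : ∀ v, M v ∈ Matrix.unitaryGroup (β v) ℂ) :
    piMatrix M ∈ Matrix.unitaryGroup (∀ v, β v) ℂ := by
  rw [Matrix.mem_unitaryGroup_iff']
  ext a b
  have h : ∀ v, ∑ j, star (M v j (a v)) * M v j (b v) = if a v = b v then 1 else 0 := by
    intro v
    have := congrFun (congrFun ((Matrix.mem_unitaryGroup_iff').1 (hM v)) (a v)) (b v)
    simpa [Matrix.mul_apply, Matrix.star_apply, Matrix.one_apply] using this
  calc (star (piMatrix M) * piMatrix M) a b
      = ∑ c : ∀ v, β v, ∏ v, star (M v (c v) (a v)) * M v (c v) (b v) := by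
        simp [Matrix.mul_apply, Matrix.star_apply, piMatrix, Finset.prod_mul_distrib]
    _ = ∏ v, ∑ j, star (M v j (a v)) * M v j (b v) := by
        rw [Finset.prod_univ_sum, Fintype.piFinset_univ]
    _ = (1 : Matrix _ _ ℂ) a b := by
        simp_rw [h]
        rw [Finset.prod_ite_zero]
        simp only [Matrix.one_apply, funext_iff, Finset.mem_univ, forall_true_left,
          Finset.prod_const_one]

/-- The matrix acting on the second of three registers, controlled by the first. -/
def controlledMatrix {α β γ : Type*} [DecidableEq α] [DecidableEq γ] (N : α → Matrix β β ℂ) :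
    Matrix ((α × β) × γ) ((α × β) × γ) ℂ :=
  fun b b' => if b.1.1 = b'.1.1 ∧ b.2 = b'.2 then N b'.1.1 b.1.2 b'.1.2 else 0

theorem controlledMatrix_mem_unitaryGroup {α β γ : Type*} [Fintype α] [Fintype β] [Fintype γ]
    [DecidableEq α] [DecidableEq β] [DecidableEq γ] {N : α → Matrix β β ℂ}
    (hN : ∀ a, N a ∈ Matrix.unitaryGroup β ℂ) :
    controlledMatrix (γ := γ) N ∈ Matrix.unitaryGroup ((α × β) × γ) ℂ := by
  rw [Matrix.mem_unitaryGroup_iff']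
  ext ⟨⟨a, w⟩, r⟩ ⟨⟨a', w'⟩, r'⟩
  have h := congrFun (congrFun ((Matrix.mem_unitaryGroup_iff').1 (hN a')) w) w'
  simp only [Matrix.mul_apply, Matrix.star_apply, Matrix.one_apply] at h
  simp only [Matrix.mul_apply, Matrix.star_apply, Matrix.one_apply, controlledMatrix,
    Fintype.sum_prod_type, Prod.mk.injEq]
  rw [Finset.sum_eq_single a']
  · rw [Finset.sum_comm, Finset.sum_eq_single r']
    · by_cases ha : a' = a <;> by_cases hr : r' = r <;>
        simp_all [eq_comm]
    · intro s _ hs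
      simp [hs]
    · simp
  · intro s _ hs
    simp [hs]
  · simp

/-! ### States of a protocol that are images of basis maps -/

theorem exchange_exchange {V : Type} {cap : V → V → ℕ∞} {K : ℕ} {W : V → Type}
    (c : GlobalBasis cap K W) : exchange (exchange c) = c := rfl

namespace QProtocol

variable {V : Type} [Fintype V] [DecidableEq V] {cap : V → V → ℕ∞} {X : Type} [Fintype X]
  [DecidableEq X]

/-- All incoming channels are clear in the basis state `c`. -/
def InClear (A : QProtocol V cap X) (c : A.Basis) : Prop :=
  ∀ v u, (c v).2.2 u = clearMsg A.K (cap u v)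

theorem compute_pushState (A : QProtocol V cap X) {ι : Type*} [Fintype ι] (n : ℕ)
    (Φ : ι → A.Basis) (ψ : ι → ℂ) (b : A.Basis) :
    A.compute n (pushState Φ ψ) b = ∑ i, (∏ v, A.step n v (b v) (Φ i v)) * ψ i := by
  simp only [compute, pushState, Finset.mul_sum]
  rw [Finset.sum_comm]
  refine Finset.sum_congr rfl fun i _ => ?_
  simp [mul_ite]

/-- If in round `n` every processor permutes its basis states so as to turn `Φ i` into `Ψ i`, then
the internal computation turns the image of a state under `Φ` into its image under `Ψ`. -/
theorem compute_pushState_of_basisPerm (A : QProtocol V cap X) {ι : Type*} [Fintype ι] {n : ℕ}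
    {Φ Ψ : ι → A.Basis} {ψ : ι → ℂ}
    {σ : ∀ v, Equiv.Perm (LocalBasis cap A.K (fun u => X × A.Anc u) v)}
    (hstep : ∀ v, A.step n v = basisPerm (σ v)) (h : ∀ i, ψ i ≠ 0 → ∀ v, σ v (Φ i v) = Ψ i v) :
    A.compute n (pushState Φ ψ) = pushState Ψ ψ := by
  funext b
  rw [compute_pushState, pushState]
  refine Finset.sum_congr rfl fun i _ => ?_
  by_cases hi : ψ i = 0
  · simp [hi]
  simp only [hstep, basisPerm, h i hi]
  rw [Finset.prod_ite_zero]
  simp [funext_iff, eq_comm]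

theorem pushState_exchange (A : QProtocol V cap X) {ι : Type*} [Fintype ι]
    (Φ : ι → A.Basis) (ψ : ι → ℂ) :
    (fun c => pushState Φ ψ (exchange c)) = pushState (fun i => (exchange (Φ i) : A.Basis)) ψ := by
  funext c
  refine Finset.sum_congr rfl fun i _ => ?_
  have : Φ i = exchange c ↔ (exchange (Φ i) : A.Basis) = c :=
    ⟨fun h => by rw [h, exchange_exchange], fun h => by rw [← h, exchange_exchange]⟩
  simp [this]

theorem isClear_pushState (A : QProtocol V cap X) {ι : Type*} [Fintype ι]
    {Φ : ι → A.Basis} {ψ : ι → ℂ} (h : ∀ i, ψ i ≠ 0 → A.InClear (Φ i)) :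
    A.IsClear (pushState Φ ψ) := by
  intro c hc
  obtain ⟨i, hi, rfl⟩ := exists_of_pushState_ne_zero hc
  exact h i hi

end QProtocol

/-! ### Moving registers between the parties -/

/-- A register that has to go from `o` to `d`, and is in the channel at time `τ` if `o ≠ d`, is in
the workspace of `p` at time `m`. -/
def Held {Q : Type} (o d : Q) (τ m : ℕ) (p : Q) : Prop :=
  (o = p ∧ (d = p ∨ m < τ)) ∨ (d = p ∧ o ≠ p ∧ τ < m)

/-- A register that has to go from `o` to `d`, and is in the channel at time `τ` if `o ≠ d`, is in
the channel from `p'` to `p` at time `m`. -/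
def InTransit {Q : Type} (o d : Q) (τ m : ℕ) (p' p : Q) : Prop :=
  o = p' ∧ d = p ∧ p' ≠ p ∧ τ = m

/-- What a party holds or has just received at time `m` is what it keeps or sends at the next
time. -/
theorem held_or_received_iff {Q : Type} (o d : Q) (τ m : ℕ) (p : Q) :
    (Held o d τ m p ∨ ∃ p', InTransit o d τ m p' p) ↔
      (Held o d τ (m + 1) p ∨ ∃ p', InTransit o d τ (m + 1) p p') := by
  have h1 : (∃ p', InTransit o d τ m p' p) ↔ (d = p ∧ o ≠ p ∧ τ = m) :=
    ⟨fun ⟨p', h⟩ => ⟨h.2.1, h.1 ▸ h.2.2.1, h.2.2.2⟩, fun h => ⟨o, rfl, h.1, h.2.1, h.2.2⟩⟩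
  have h2 : (∃ p', InTransit o d τ (m + 1) p p') ↔ (o = p ∧ d ≠ p ∧ τ = m + 1) :=
    ⟨fun ⟨p', h⟩ => ⟨h.1, fun h' => h.2.2.1 (h' ▸ h.2.1), h.2.2.2⟩,
      fun h => ⟨d, h.1, rfl, fun h' => h.2.1 h'.symm, h.2.2⟩⟩
  rw [h1, h2, Held, Held]
  by_cases ho : o = p <;> by_cases hd : d = p <;> simp [ho, hd] <;> omega

/-- How the processors of the network of `A` are distributed over the parties `Q` of another
network, which receive inputs in `X'`. -/
structure Schedule {V : Type} [Fintype V] [DecidableEq V] {cap : V → V → ℕ∞} {X : Type} [Fintype X]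
    [DecidableEq X] (A : QProtocol V cap X) (Q X' : Type) where
  /-- the party that simulates processor `v` in round `t` -/
  own : ℕ → V → Q
  /-- the input of processor `v`, computed from the input of its owner -/
  inp : V → X' → X
  /-- the number of time slots for the messages of one round -/
  slots : ℕ
  /-- the time slot in which a qubit of the message from `u` to `v` is sent in round `t` -/
  slot : ℕ → (u v : V) → Fin (numQubits A.K (cap u v)) → ℕ
  /-- the content of an unused input register -/
  x₀ : X
  /-- the content of an unused workspace -/
  w₀ : (v : V) → A.Anc v
  /-- the processor whose answer a party announces -/
  reporter : Q → V

namespace Schedule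

variable {V : Type} [Fintype V] [DecidableEq V] {cap : V → V → ℕ∞} {X : Type} [Fintype X]
  [DecidableEq X] {A : QProtocol V cap X} {Q : Type} {X' : Type}
  (S : Schedule A Q X') {cap' : Q → Q → ℕ∞}

/-- The basis state of the network of `A` in which nothing is stored. -/
def blank : A.Basis :=
  fun v => ((S.x₀, S.w₀ v), fun u => clearMsg A.K (cap v u), fun u => clearMsg A.K (cap u v))

/-- The workspaces `kw` and the message qubits `km` (arrived in the channels) of a basis state; the
rest is blank. -/
noncomputable def mask (kw : V → Prop)
    (km : (u v : V) → Fin (numQubits A.K (cap u v)) → Prop) (c : A.Basis) : A.Basis :=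
  open scoped Classical in
  fun v => (if kw v then (c v).1 else (S.x₀, S.w₀ v), fun u => clearMsg A.K (cap v u),
    fun u i => if km u v i then (c v).2.2 u i else false)

theorem mask_eq_iff {kw : V → Prop} {km : (u v : V) → Fin (numQubits A.K (cap u v)) → Prop}
    {c c' : A.Basis} : S.mask kw km c = S.mask kw km c' ↔
      (∀ v, kw v → (c v).1 = (c' v).1) ∧
      ∀ u v i, km u v i → (c v).2.2 u i = (c' v).2.2 u i := by
  constructor
  · intro h
    refine ⟨fun v hv => ?_, fun u v i hi => ?_⟩
    · have := congrArg Prod.fst (congrFun h v)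
      simpa [mask, hv] using this
    · have := congrFun (congrFun (congrArg (fun l => l.2.2) (congrFun h v)) u) i
      simpa [mask, hi] using this
  · rintro ⟨h1, h2⟩
    funext v
    refine Prod.ext ?_ (Prod.ext rfl ?_)
    · simp only [mask]
      split_ifs with h
      · exact h1 v h
      · rfl
    · funext u i
      simp only [mask]
      split_ifs with h
      · exact h2 u v i h
      · rfl

theorem mask_eq_blank {kw : V → Prop} {km : (u v : V) → Fin (numQubits A.K (cap u v)) → Prop}
    (c : A.Basis) (hw : ∀ v, ¬ kw v) (hm : ∀ u v i, ¬ km u v i) : S.mask kw km c = S.blank := by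
  funext v
  simp only [mask, blank, hw, hm, if_false]
  rfl

/-- A bit string that encodes the basis state `c` as a unit vector, and the blank state by zeros.  It
determines `c` if there are at least as many bits as basis states. -/
noncomputable def encode (K : ℕ) (κ : ℕ∞) (c : A.Basis) : Msg K κ :=
  fun i => decide ((Fintype.equivFin A.Basis c).val = i.val ∧ c ≠ S.blank)

theorem encode_blank (K : ℕ) (κ : ℕ∞) : S.encode K κ S.blank = clearMsg K κ := by
  funext i
  simp [encode, clearMsg]

theorem encode_injective : Function.Injective (S.encode (Fintype.card A.Basis) ⊤) := by
  have aux : ∀ c c' : A.Basis, S.encode (Fintype.card A.Basis) ⊤ c =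
      S.encode (Fintype.card A.Basis) ⊤ c' → c ≠ S.blank → c = c' := by
    intro c c' h hc
    have := congrFun h ⟨(Fintype.equivFin A.Basis c).val, by
      simp only [numQubits, if_true]; exact (Fintype.equivFin A.Basis c).2⟩
    simp only [encode, hc, ne_eq, not_false_eq_true, and_self, decide_true, true_eq_decide_iff]
      at this
    exact ((Fintype.equivFin A.Basis).injective (Fin.ext this.1)).symm
  intro c c' h
  by_cases hc : c = S.blank
  · by_cases hc' : c' = S.blank
    · rw [hc, hc']
    · exact (aux c' c h.symm hc').symm
  · exact aux c c' h hc

/-- The content of the workspace of `p` at time `m` of round `t`, as a function of the state `c` of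
the simulated network before its messages are moved.  At time `0` it consists of everything that the
processors owned by `p` act on; later the messages are stored as arrived in the channels.  The step
to time `1` only changes this representation: a register travels in slot `s` at time `s + 2`.  A
processor that changes its owner travels in slot `0`. -/
noncomputable def hold [DecidableEq Q] (t : ℕ) : ℕ → Q → A.Basis → A.Basis
  | 0, p, c => fun v => if S.own t v = p then c v else S.blank v
  | m + 1, p, c => S.mask (fun v => Held (S.own t v) (S.own (t + 1) v) 2 (m + 1) p)
      (fun u v i => Held (S.own t u) (S.own (t + 1) v) (S.slot t u v i + 2) (m + 1) p) (exchange c)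

/-- The content of the channel from `p'` to `p` at time `m` of round `t`.  An unbounded channel
transmits several registers at once, other channels at most one qubit. -/
noncomputable def chan (cap' : Q → Q → ℕ∞) (t m : ℕ) (p' p : Q) (c : A.Basis) :
    Msg (Fintype.card A.Basis) (cap' p' p) :=
  open scoped Classical in
  if cap' p' p = ⊤ then S.encode _ _
    (S.mask (fun v => InTransit (S.own t v) (S.own (t + 1) v) 2 m p' p)
      (fun u v i => InTransit (S.own t u) (S.own (t + 1) v) (S.slot t u v i + 2) m p' p)
      (exchange c))
  else fun _ => decide (∃ u v i,
    InTransit (S.own t u) (S.own (t + 1) v) (S.slot t u v i + 2) m p' p ∧ (c u).2.1 v i = true)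

/-- What the parties must be able to communicate: a processor changes its owner only through an
unbounded channel, and no two message qubits use the same slot of a bounded channel. -/
structure Valid (cap' : Q → Q → ℕ∞) (T : ℕ) : Prop where
  slots_pos : 0 < S.slots
  slot_lt : ∀ t u v i, S.slot t u v i < S.slots
  one_le : ∀ p p', p ≠ p' → 1 ≤ cap' p p'
  own_change : ∀ t < T, ∀ v, S.own t v ≠ S.own (t + 1) v → cap' (S.own t v) (S.own (t + 1) v) = ⊤
  slot_inj : ∀ t < T, ∀ u v i u' v' i', S.own t u ≠ S.own (t + 1) v →
    cap' (S.own t u) (S.own (t + 1) v) ≠ ⊤ → S.own t u' = S.own t u →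
    S.own (t + 1) v' = S.own (t + 1) v → S.slot t u' v' i' = S.slot t u v i →
    (⟨u', v', i'⟩ : (u : V) × (v : V) × Fin (numQubits A.K (cap u v))) = ⟨u, v, i⟩

variable {S} {T : ℕ}

/-- As long as all channels are clear, what `p` holds is determined by the registers it holds, also
at time `0`, when the registers are stored in a different way. -/
theorem hold_eq_iff [DecidableEq Q] (t m : ℕ) (p : Q) {c c' : A.Basis} (hc : A.InClear c) (hc' : A.InClear c') :
    S.hold t m p c = S.hold t m p c' ↔
      (∀ v, Held (S.own t v) (S.own (t + 1) v) 2 m p → (c v).1 = (c' v).1) ∧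
      ∀ u v i, Held (S.own t u) (S.own (t + 1) v) (S.slot t u v i + 2) m p →
        (c u).2.1 v i = (c' u).2.1 v i := by
  cases m with
  | zero =>
    have held0 : ∀ (o d : Q) (τ : ℕ), Held o d (τ + 2) 0 p ↔ o = p := by
      intro o d τ
      simp [Held]
    have held0' : ∀ (o d : Q), Held o d 2 0 p ↔ o = p := fun o d => held0 o d 0
    simp only [held0, hold]
    constructor
    · intro h
      have h' : ∀ v, S.own t v = p → c v = c' v := by
        intro v hv
        simpa [hv] using congrFun h v
      exact ⟨fun v hv => by rw [h' v hv], fun u v i hu => by rw [h' u hu]⟩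
    · rintro ⟨h1, h2⟩
      funext v
      split_ifs with hv
      · refine Prod.ext (h1 v hv) (Prod.ext ?_ ?_)
        · funext u i
          exact h2 v u i hv
        · funext u
          rw [hc, hc']
      · rfl
  | succ m => exact S.mask_eq_iff

theorem chan_eq_iff (hS : S.Valid cap' T) {t : ℕ} (ht : t < T) (m : ℕ) (p' p : Q) (c c' : A.Basis) :
    S.chan cap' t m p' p c = S.chan cap' t m p' p c' ↔
      (∀ v, InTransit (S.own t v) (S.own (t + 1) v) 2 m p' p → (c v).1 = (c' v).1) ∧
      ∀ u v i, InTransit (S.own t u) (S.own (t + 1) v) (S.slot t u v i + 2) m p' p →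
        (c u).2.1 v i = (c' u).2.1 v i := by
  by_cases hcap : cap' p' p = ⊤
  · simp only [chan, hcap, if_true]
    have hinj : Function.Injective (S.encode (Fintype.card A.Basis) (cap' p' p)) := by
      rw [hcap]; exact S.encode_injective
    rw [hinj.eq_iff]
    exact S.mask_eq_iff
  · simp only [chan, hcap, if_false]
    constructor
    · intro h
      refine ⟨fun v hv => ?_, fun u v i hi => ?_⟩
      · exfalso
        refine hcap ?_
        have := hS.own_change t ht v (by rw [hv.1, hv.2.1]; exact hv.2.2.1)
        rwa [hv.1, hv.2.1] at this
      · have hq : 0 < numQubits (Fintype.card A.Basis) (cap' p' p) := by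
          have := hS.one_le p' p hi.2.2.1
          simp only [numQubits, hcap, if_false]
          lift cap' p' p to ℕ using hcap with k
          simpa [Nat.one_le_iff_ne_zero, Nat.pos_iff_ne_zero] using this
        have := congrFun h ⟨0, hq⟩
        simp only [decide_eq_decide] at this
        -- The qubit in the channel is the only one that travels there at this time.
        have key : ∀ d : A.Basis, (∃ u v i,
            InTransit (S.own t u) (S.own (t + 1) v) (S.slot t u v i + 2) m p' p ∧
              (d u).2.1 v i = true) ↔ (d u).2.1 v i = true := by
          intro d
          refine ⟨?_, fun hd => ⟨u, v, i, hi, hd⟩⟩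
          rintro ⟨u', v', i', hi', hd⟩
          have := hS.slot_inj t ht u v i u' v' i' (by rw [hi.1, hi.2.1]; exact hi.2.2.1)
            (by rw [hi.1, hi.2.1]; exact hcap) (by rw [hi.1, hi'.1]) (by rw [hi.2.1, hi'.2.1])
            (by have h1 := hi.2.2.2; have h2 := hi'.2.2.2; omega)
          cases this
          exact hd
        rw [key, key] at this
        exact Bool.eq_iff_iff.2 this
    · rintro ⟨-, h⟩
      funext _
      refine decide_eq_decide.2 ?_
      constructor
      · rintro ⟨u, v, i, hi, hd⟩
        exact ⟨u, v, i, hi, by rw [← h u v i hi]; exact hd⟩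
      · rintro ⟨u, v, i, hi, hd⟩
        exact ⟨u, v, i, hi, by rw [h u v i hi]; exact hd⟩

theorem chan_eq_clear {t m : ℕ} (hm : ∀ τ < S.slots, τ + 2 ≠ m) (hS : S.Valid cap' T) (p' p : Q)
    (c : A.Basis) : S.chan cap' t m p' p c = clearMsg _ _ := by
  have h1 : ∀ v, ¬ InTransit (S.own t v) (S.own (t + 1) v) 2 m p' p :=
    fun v h => hm 0 hS.slots_pos h.2.2.2
  have h2 : ∀ u v i, ¬ InTransit (S.own t u) (S.own (t + 1) v) (S.slot t u v i + 2) m p' p :=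
    fun u v i h => hm _ (hS.slot_lt t u v i) h.2.2.2
  unfold chan
  split_ifs with hcap
  · rw [S.mask_eq_blank _ h1 h2, encode_blank]
  · simp only [h2, false_and, exists_false, decide_false]
    rfl

variable (S)

/-- What `p` acts on at time `m` of round `t`, when messages have just arrived. -/
noncomputable def recv [DecidableEq Q] (cap' : Q → Q → ℕ∞) (t m : ℕ) (p : Q) (y : X' × A.Basis) :
    LocalBasis cap' (Fintype.card A.Basis) (fun _ => X' × A.Basis) p :=
  ((y.1, S.hold t m p y.2), fun _ => clearMsg _ _, fun p' => S.chan cap' t m p' p y.2)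

/-- What `p` acts on just before time `m` of round `t`, when messages are about to be sent. -/
noncomputable def sent [DecidableEq Q] (cap' : Q → Q → ℕ∞) (t m : ℕ) (p : Q) (y : X' × A.Basis) :
    LocalBasis cap' (Fintype.card A.Basis) (fun _ => X' × A.Basis) p :=
  ((y.1, S.hold t m p y.2), fun p' => S.chan cap' t m p p' y.2, fun _ => clearMsg _ _)

variable {S}

/-- The view of `p` before it acts and the view after it has acted distinguish the same basis states,
so a permutation can turn one into the other. -/
theorem recv_eq_iff_sent_eq [DecidableEq Q] (hS : S.Valid cap' T) {t : ℕ} (ht : t < T) (m : ℕ) (p : Q)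
    (y z : X' × {c : A.Basis // A.InClear c}) :
    S.recv cap' t m p (y.1, y.2.1) = S.recv cap' t m p (z.1, z.2.1) ↔
      S.sent cap' t (m + 1) p (y.1, y.2.1) = S.sent cap' t (m + 1) p (z.1, z.2.1) := by
  have hr : S.recv cap' t m p (y.1, y.2.1) = S.recv cap' t m p (z.1, z.2.1) ↔
      y.1 = z.1 ∧ S.hold t m p y.2 = S.hold t m p z.2 ∧
        ∀ p', S.chan cap' t m p' p y.2.1 = S.chan cap' t m p' p z.2.1 := by
    simp [recv, Prod.ext_iff, funext_iff, and_assoc]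
  have hs : S.sent cap' t (m + 1) p (y.1, y.2.1) = S.sent cap' t (m + 1) p (z.1, z.2.1) ↔
      y.1 = z.1 ∧ S.hold t (m + 1) p y.2 = S.hold t (m + 1) p z.2 ∧
        ∀ p', S.chan cap' t (m + 1) p p' y.2.1 = S.chan cap' t (m + 1) p p' z.2.1 := by
    simp [sent, Prod.ext_iff, funext_iff, and_assoc]
  rw [hr, hs, hold_eq_iff t m p y.2.2 z.2.2, hold_eq_iff t (m + 1) p y.2.2 z.2.2]
  simp only [chan_eq_iff hS ht]
  refine and_congr_right fun _ => ?_
  constructor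
  · rintro ⟨⟨h1, h2⟩, h3⟩
    have hw : ∀ v, (Held (S.own t v) (S.own (t + 1) v) 2 m p ∨
        ∃ p', InTransit (S.own t v) (S.own (t + 1) v) 2 m p' p) →
          (y.2.1 v).1 = (z.2.1 v).1 := by
      rintro v (h | ⟨p', h⟩)
      exacts [h1 v h, (h3 p').1 v h]
    have hb : ∀ u v i, (Held (S.own t u) (S.own (t + 1) v) (S.slot t u v i + 2) m p ∨
        ∃ p', InTransit (S.own t u) (S.own (t + 1) v) (S.slot t u v i + 2) m p' p) →
          (y.2.1 u).2.1 v i = (z.2.1 u).2.1 v i := by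
      rintro u v i (h | ⟨p', h⟩)
      exacts [h2 u v i h, (h3 p').2 u v i h]
    simp only [held_or_received_iff] at hw hb
    exact ⟨⟨fun v h => hw v (.inl h), fun u v i h => hb u v i (.inl h)⟩,
      fun p' => ⟨fun v h => hw v (.inr ⟨p', h⟩), fun u v i h => hb u v i (.inr ⟨p', h⟩)⟩⟩
  · rintro ⟨⟨h1, h2⟩, h3⟩
    have hw : ∀ v, (Held (S.own t v) (S.own (t + 1) v) 2 (m + 1) p ∨
        ∃ p', InTransit (S.own t v) (S.own (t + 1) v) 2 (m + 1) p p') →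
          (y.2.1 v).1 = (z.2.1 v).1 := by
      rintro v (h | ⟨p', h⟩)
      exacts [h1 v h, (h3 p').1 v h]
    have hb : ∀ u v i, (Held (S.own t u) (S.own (t + 1) v) (S.slot t u v i + 2) (m + 1) p ∨
        ∃ p', InTransit (S.own t u) (S.own (t + 1) v) (S.slot t u v i + 2) (m + 1) p p') →
          (y.2.1 u).2.1 v i = (z.2.1 u).2.1 v i := by
      rintro u v i (h | ⟨p', h⟩)
      exacts [h2 u v i h, (h3 p').2 u v i h]
    simp only [← held_or_received_iff] at hw hb
    exact ⟨⟨fun v h => hw v (.inl h), fun u v i h => hb u v i (.inl h)⟩,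
      fun p' => ⟨fun v h => hw v (.inr ⟨p', h⟩), fun u v i h => hb u v i (.inr ⟨p', h⟩)⟩⟩

end Schedule

/-! ### The simulating protocol -/

namespace Schedule

variable {V : Type} [Fintype V] [DecidableEq V] {cap : V → V → ℕ∞} {X : Type} [Fintype X]
  [DecidableEq X] {A : QProtocol V cap X} {Q : Type} {X' : Type}
  (S : Schedule A Q X') {cap' : Q → Q → ℕ∞} {T : ℕ}

/-- The relabelling of the input register of `v` that exchanges `x` with the blank content.  It is
an involution, and lets an input-independent initial state stand for the input `x`. -/
def frame (x : X) (v : V) : Equiv.Perm (LocalBasis cap A.K (fun u => X × A.Anc u) v) :=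
  Equiv.prodCongr (Equiv.prodCongr (Equiv.swap S.x₀ x) (Equiv.refl _)) (Equiv.refl _)

/-- The relabelling of all input registers, see `Schedule.frame`. -/
def frameAll (x : V → X) : Equiv.Perm A.Basis :=
  Equiv.piCongrRight fun v => S.frame (x v) v

/-- The state of the simulated protocol after `t` rounds, with relabelled input registers. -/
noncomputable def framedRun (x : V → X) (t : ℕ) : A.Basis → ℂ :=
  fun c => A.run x t (S.frameAll x c)

/-- The state of the simulated protocol after the internal computations of round `t`, with
relabelled input registers. -/
noncomputable def framedCompute (x : V → X) (t : ℕ) : A.Basis → ℂ :=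
  fun c => A.compute t (A.run x t) (S.frameAll x c)

/-- The initial basis state in which the shared registers contain `w` and all else is blank. -/
def start (w : (v : V) → A.Anc v) : A.Basis :=
  fun v => ((S.x₀, w v), fun u => clearMsg A.K (cap v u), fun u => clearMsg A.K (cap u v))

theorem framedRun_zero (x : V → X) : S.framedRun x 0 = pushState S.start A.ent := by
  classical
  funext c
  simp only [framedRun, QProtocol.run, QProtocol.init, pushState]
  have hx : ∀ v, (S.frameAll x c v).1.1 = x v ↔ (c v).1.1 = S.x₀ := by
    intro v
    change Equiv.swap S.x₀ (x v) (c v).1.1 = x v ↔ _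
    rw [← Equiv.apply_eq_iff_eq (Equiv.swap S.x₀ (x v)), Equiv.swap_apply_self,
      Equiv.swap_apply_right]
  simp only [hx]
  change (if (∀ v, (c v).1.1 = S.x₀) ∧ ∀ v u, (c v).2.1 u = clearMsg A.K (cap v u) ∧
    (c v).2.2 u = clearMsg A.K (cap u v) then A.ent (fun v => (c v).1.2) else 0) = _
  split_ifs with h
  · rw [Finset.sum_eq_single (fun v => (c v).1.2)]
    · rw [if_pos]
      funext v
      refine Prod.ext (Prod.ext (h.1 v).symm rfl) (Prod.ext ?_ ?_)
      · exact funext fun u => (h.2 v u).1.symm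
      · exact funext fun u => (h.2 v u).2.symm
    · intro w _ hw
      rw [if_neg]
      rintro rfl
      exact hw rfl
    · simp
  · symm
    refine Finset.sum_eq_zero fun w _ => if_neg ?_
    rintro rfl
    exact h ⟨fun v => rfl, fun v u => ⟨rfl, rfl⟩⟩

theorem framedRun_succ (x : V → X) (t : ℕ) :
    S.framedRun x (t + 1) = fun c => S.framedCompute x t (exchange c) := rfl

theorem inClear_of_framedCompute_ne_zero {x : V → X} {t : ℕ}
    (hclear : A.IsClear (A.compute t (A.run x t))) (c : A.Basis)
    (hc : S.framedCompute x t c ≠ 0) : A.InClear c :=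
  hclear (S.frameAll x c) hc

theorem framedCompute_apply (x : V → X) (t : ℕ) (c : A.Basis) :
    S.framedCompute x t c = ∑ c' : A.Basis,
      (∏ v, A.step t v (S.frame (x v) v (c v)) (S.frame (x v) v (c' v))) * S.framedRun x t c' :=
  (Equiv.sum_comp (S.frameAll x) fun c' : A.Basis =>
    (∏ v, A.step t v (S.frame (x v) v (c v)) (c' v)) * A.run x t c').symm

variable [DecidableEq Q]

/-- The internal computations of round `t` of the processors owned by `p`, when the input of `p` is
`a` and the input registers are relabelled. -/
noncomputable def localStep (t : ℕ) (p : Q) (a : X') : Matrix A.Basis A.Basis ℂ :=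
  piMatrix fun v => if S.own t v = p then
    (A.step t v).submatrix (S.frame (S.inp v a) v) (S.frame (S.inp v a) v) else 1

theorem localStep_mem_unitaryGroup [DecidableEq A.Basis] (t : ℕ) (p : Q) (a : X') :
    S.localStep t p a ∈ Matrix.unitaryGroup A.Basis ℂ := by
  refine piMatrix_mem_unitaryGroup (β := LocalBasis cap A.K (fun u => X × A.Anc u))
    (M := fun v => if S.own t v = p then
      (A.step t v).submatrix (S.frame (S.inp v a) v) (S.frame (S.inp v a) v) else 1) fun v => ?_
  split_ifs
  · have h := (Matrix.mem_unitaryGroup_iff').1 (A.step_unitary t v)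
    rw [Matrix.mem_unitaryGroup_iff']
    rw [Matrix.star_eq_conjTranspose] at h ⊢
    rw [Matrix.conjTranspose_submatrix, Matrix.submatrix_mul_equiv, h, Matrix.submatrix_one_equiv]
  · exact one_mem _

theorem hold_zero_start_injective :
    Function.Injective fun (w : (v : V) → A.Anc v) (p : Q) => S.hold 0 0 p (S.start w) := by
  intro w w' h
  funext v
  have := congrFun (congrFun h (S.own 0 v)) v
  simp only [hold, if_true, start] at this
  exact congrArg (fun l => l.1.2) this

variable [Fintype Q] [Fintype X'] [DecidableEq X']

/-- The protocol in which the parties simulate the protocol `A` according to the schedule `S`.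
Each round is simulated in `S.slots + 3` rounds: one in which every party performs the internal
computations of the processors it owns, and `S.slots + 2` to move registers to their new owners, at
the times `1`, …, `S.slots + 2` of `Schedule.hold`. -/
noncomputable def protocol (cap' : Q → Q → ℕ∞) : QProtocol Q cap' X' where
  K := Fintype.card A.Basis
  Anc := fun _ => A.Basis
  decEqAnc := fun _ => Classical.decEq _
  ent := pushState (fun w p => S.hold 0 0 p (S.start w)) A.ent
  ent_unit := by
    have := sum_pushState_of_injective S.hold_zero_start_injective A.ent (fun _ => True)
    simp only [if_true] at this
    rw [← A.ent_unit, ← this]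
  step := fun n p =>
    letI : DecidableEq A.Basis := Classical.decEq _
    if n % (S.slots + 3) = 0 then controlledMatrix (S.localStep (n / (S.slots + 3)) p)
    else basisPerm (transportPerm
      (fun y : X' × {c : A.Basis // A.InClear c} =>
        S.recv cap' (n / (S.slots + 3)) (n % (S.slots + 3) - 1) p (y.1, y.2.1))
      (fun y => S.sent cap' (n / (S.slots + 3)) (n % (S.slots + 3)) p (y.1, y.2.1)))
  step_unitary := by
    intro n p
    let : DecidableEq A.Basis := Classical.decEq _
    split_ifs
    · exact controlledMatrix_mem_unitaryGroup fun a => S.localStep_mem_unitaryGroup _ p a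
    · exact basisPerm_mem_unitaryGroup _
  answer := fun p w =>
    A.answer (S.reporter p) (S.frame (S.inp (S.reporter p) w.1) (S.reporter p)
      (w.2 (S.reporter p))).1

/-- The basis state of the simulating network at time `m` of round `t` on input `x'`, as a function
of the basis state of the simulated network. -/
noncomputable def conf (cap' : Q → Q → ℕ∞) (t m : ℕ) (x' : Q → X') (c : A.Basis) :
    (S.protocol cap').Basis :=
  fun p => S.recv cap' t m p (x' p, c)

/-- The basis state before the messages that arrive at time `m` are exchanged; applying `exchange`
yields `Schedule.conf`. -/
noncomputable def preConf (cap' : Q → Q → ℕ∞) (t m : ℕ) (x' : Q → X') (c : A.Basis) :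
    (S.protocol cap').Basis :=
  fun p => S.sent cap' t m p (x' p, c)

theorem inClear_preConf (t m : ℕ) (x' : Q → X') (c : A.Basis) :
    (S.protocol cap').InClear (S.preConf cap' t m x' c) := fun _ _ => rfl

theorem conf_zero_injective (t : ℕ) (x' : Q → X') : Function.Injective (S.conf cap' t 0 x') := by
  intro c c' h
  funext v
  have := congrFun (congrArg (fun l => l.1.2) (congrFun h (S.own t v))) v
  simpa [conf, recv, hold] using this

variable {S}

theorem conf_zero_eq_preConf_zero (hS : S.Valid cap' T) (t : ℕ) (x' : Q → X') :
    S.conf cap' t 0 x' = S.preConf cap' t 0 x' := by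
  funext c p
  refine Prod.ext rfl (Prod.ext ?_ ?_)
  · exact funext fun p' => (chan_eq_clear (by simp) hS p p' c).symm
  · exact funext fun p' => chan_eq_clear (by simp) hS p' p c

theorem init_eq_pushState (hS : S.Valid cap' T) (x' : Q → X') :
    (S.protocol cap').init x' = pushState (S.conf cap' 0 0 x') (pushState S.start A.ent) := by
  classical
  rw [pushState_pushState, conf_zero_eq_preConf_zero hS]
  funext c
  simp only [QProtocol.init]
  split_ifs with h
  · refine Finset.sum_congr rfl fun w _ => ?_
    have hiff : (fun p => S.hold 0 0 p (S.start w)) = (fun p => (c p).1.2) ↔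
        S.preConf cap' 0 0 x' (S.start w) = c := by
      constructor
      swap
      · rintro rfl
        rfl
      intro hw
      funext p
      refine Prod.ext (Prod.ext (h.1 p).symm (congrFun hw p)) (Prod.ext ?_ ?_)
      · funext u
        exact (chan_eq_clear (by simp) hS p u _).trans (h.2 p u).1.symm
      · exact funext fun u => (h.2 p u).2.symm
    by_cases hw : (fun p => S.hold 0 0 p (S.start w)) = (fun p => (c p).1.2)
    · rw [if_pos hw, if_pos (hiff.1 hw)]
    · rw [if_neg hw, if_neg (mt hiff.2 hw)]
  · symm
    refine Finset.sum_eq_zero fun w _ => if_neg ?_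
    rintro rfl
    exact h ⟨fun _ => rfl, fun p u => ⟨chan_eq_clear (by simp) hS p u _, rfl⟩⟩

/-- In the first of the rounds that simulate round `t`, the parties perform the internal
computations of the processors. -/
theorem compute_conf_zero (hS : S.Valid cap' T) {t : ℕ} {x' : Q → X'} {x : V → X}
    (hx : ∀ v, S.inp v (x' (S.own t v)) = x v) :
    (S.protocol cap').compute (t * (S.slots + 3)) (pushState (S.conf cap' t 0 x') (S.framedRun x t))
      = pushState (S.conf cap' t 0 x') (S.framedCompute x t) := by
  funext b
  rw [QProtocol.compute_pushState]
  have hstep : ∀ p l l', (S.protocol cap').step (t * (S.slots + 3)) p l l' =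
      if l.1.1 = l'.1.1 ∧ l.2 = l'.2 then S.localStep t p l'.1.1 l.1.2 l'.1.2 else 0 := by
    intro p l l'
    simp only [protocol, Nat.mul_mod_left, if_true, controlledMatrix]
    rw [Nat.mul_div_cancel _ (Nat.succ_pos _)]
    congr
  have hclear : S.conf cap' t 0 x' = S.preConf cap' t 0 x' := conf_zero_eq_preConf_zero hS t x'
  by_cases hb : ∃ c, S.conf cap' t 0 x' c = b
  · obtain ⟨c, rfl⟩ := hb
    rw [pushState_apply_of_injective (S.conf_zero_injective t x'), framedCompute_apply]
    refine Finset.sum_congr rfl fun c' _ => ?_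
    congr 1
    calc ∏ p, (S.protocol cap').step (t * (S.slots + 3)) p
            (S.conf cap' t 0 x' c p) (S.conf cap' t 0 x' c' p)
        = ∏ p, ∏ v, if S.own t v = p then
            A.step t v (S.frame (x v) v (c v)) (S.frame (x v) v (c' v)) else 1 := by
          refine Finset.prod_congr rfl fun p _ => ?_
          rw [hstep, if_pos ⟨rfl, by rw [hclear]; refine Prod.ext (funext fun u => ?_) rfl
                                     exact (chan_eq_clear (by simp) hS p u _).trans
                                       (chan_eq_clear (by simp) hS p u _).symm⟩]
          refine Finset.prod_congr rfl fun v _ => ?_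
          change (if S.own t v = p then (A.step t v).submatrix (S.frame (S.inp v (x' p)) v)
            (S.frame (S.inp v (x' p)) v) else 1) (S.hold t 0 p c v) (S.hold t 0 p c' v) = _
          by_cases hv : S.own t v = p
          · subst hv
            simp [hold, hx]
          · have hh : S.hold t 0 p c v = S.hold t 0 p c' v := by simp [hold, hv]
            rw [if_neg hv, if_neg hv, hh]
            exact Matrix.one_apply_eq _
      _ = ∏ v, A.step t v (S.frame (x v) v (c v)) (S.frame (x v) v (c' v)) := by
          rw [Finset.prod_comm]
          simp
  · have hR : pushState (S.conf cap' t 0 x') (S.framedCompute x t) b = 0 := by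
      by_contra h
      obtain ⟨c, -, hc⟩ := exists_of_pushState_ne_zero h
      exact hb ⟨c, hc⟩
    rw [hR]
    refine Finset.sum_eq_zero fun c' _ => ?_
    by_contra h
    have hp := Finset.prod_ne_zero_iff.1 (left_ne_zero_of_mul h)
    -- A nonzero product forces every register to be unchanged outside the workspace of its owner.
    refine hb ⟨fun v => (b (S.own t v)).1.2 v, ?_⟩
    funext p
    have hpp := hp p (Finset.mem_univ _)
    rw [hstep] at hpp
    have hcond : (b p).1.1 = (S.conf cap' t 0 x' c' p).1.1 ∧ (b p).2 = (S.conf cap' t 0 x' c' p).2 := by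
      by_contra hcon
      exact hpp (if_neg hcon)
    rw [if_pos hcond] at hpp
    have hloc := Finset.prod_ne_zero_iff.1 hpp
    refine Prod.ext (Prod.ext hcond.1.symm ?_) ?_
    · funext v
      have hv : (if S.own t v = p then (A.step t v).submatrix (S.frame (S.inp v (x' p)) v)
          (S.frame (S.inp v (x' p)) v) else 1) ((b p).1.2 v) (S.hold t 0 p c' v) ≠ 0 :=
        hloc v (Finset.mem_univ _)
      change (if S.own t v = p then (b (S.own t v)).1.2 v else S.blank v) = (b p).1.2 v
      by_cases ho : S.own t v = p
      · rw [if_pos ho, ho]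
      · simp only [ho, if_false, hold, Matrix.one_apply, ne_eq, ite_eq_right_iff,
          one_ne_zero, imp_false, not_not] at hv
        rw [if_neg ho, hv]
    · rw [hcond.2, hclear]
      refine Prod.ext (funext fun u => ?_) rfl
      exact (chan_eq_clear (by simp) hS p u _).trans (chan_eq_clear (by simp) hS p u _).symm

/-- In the other rounds that simulate round `t`, the parties move registers. -/
theorem compute_conf (hS : S.Valid cap' T) {t : ℕ} (ht : t < T) {m : ℕ} (hm : m < S.slots + 2)
    (x' : Q → X') {ψ : A.Basis → ℂ} (hψ : ∀ c, ψ c ≠ 0 → A.InClear c) :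
    (S.protocol cap').compute (t * (S.slots + 3) + (m + 1)) (pushState (S.conf cap' t m x') ψ)
      = pushState (S.preConf cap' t (m + 1) x') ψ := by
  have hmod : (t * (S.slots + 3) + (m + 1)) % (S.slots + 3) = m + 1 := by
    rw [mul_comm, Nat.mul_add_mod, Nat.mod_eq_of_lt (by omega)]
  have hdiv : (t * (S.slots + 3) + (m + 1)) / (S.slots + 3) = t := by
    rw [mul_comm, Nat.mul_add_div (Nat.succ_pos _), Nat.div_eq_of_lt (by omega), add_zero]
  refine QProtocol.compute_pushState_of_basisPerm _ (σ := fun p => transportPerm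
      (fun y : X' × {c : A.Basis // A.InClear c} => S.recv cap' t m p (y.1, y.2.1))
      (fun y => S.sent cap' t (m + 1) p (y.1, y.2.1))) ?_ ?_
  · intro p
    simp only [protocol, hmod, hdiv, Nat.succ_ne_zero, if_false, Nat.add_sub_cancel]
    rfl
  · intro c hc p
    exact transportPerm_apply (recv_eq_iff_sent_eq hS ht m p) (x' p, ⟨c, hψ c hc⟩)

/-- After all messages of round `t` have been moved, the parties hold the state at the beginning of
round `t + 1`. -/
theorem conf_last (hS : S.Valid cap' T) (t : ℕ) (x' : Q → X') {c : A.Basis} (hc : A.InClear c) :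
    S.conf cap' t (S.slots + 2) x' c = S.conf cap' (t + 1) 0 x' (exchange c) := by
  funext p
  refine Prod.ext (Prod.ext rfl ?_) (Prod.ext rfl ?_)
  · have hheld : ∀ (o d : Q) (τ : ℕ), τ < S.slots →
        (Held o d (τ + 2) (S.slots + 1 + 1) p ↔ d = p) := by
      intro o d τ hτ
      by_cases ho : o = p <;> by_cases hd : d = p <;> simp [Held, ho, hd] <;> omega
    funext v
    simp only [conf, recv, hold, mask, hheld _ _ _ (hS.slot_lt t _ _ _),
      hheld _ _ 0 hS.slots_pos]
    split_ifs with hv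
    · refine Prod.ext rfl (Prod.ext ?_ rfl)
      exact funext fun u => (hc u v).symm
    · rfl
  · funext p'
    exact (chan_eq_clear (by intros; omega) hS p' p c).trans
      (chan_eq_clear (by simp) hS p' p _).symm

/-- The state of the simulating network while it simulates round `t`, and the fact that all channels
are clear whenever they have to be. -/
theorem run_round (hS : S.Valid cap' T) {t : ℕ} (ht : t < T) {x' : Q → X'} {x : V → X}
    (hx : ∀ v, S.inp v (x' (S.own t v)) = x v) (hclear : A.IsClear (A.compute t (A.run x t)))
    (hrun : (S.protocol cap').run x' (t * (S.slots + 3)) =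
      pushState (S.conf cap' t 0 x') (S.framedRun x t)) {m : ℕ} (hm : m < S.slots + 3) :
    (S.protocol cap').IsClear ((S.protocol cap').compute (t * (S.slots + 3) + m)
      ((S.protocol cap').run x' (t * (S.slots + 3) + m))) ∧
    (S.protocol cap').run x' (t * (S.slots + 3) + (m + 1)) =
      pushState (S.conf cap' t m x') (S.framedCompute x t) := by
  have hψ := S.inClear_of_framedCompute_ne_zero hclear
  induction m with
  | zero =>
    rw [add_zero, hrun, compute_conf_zero hS hx, conf_zero_eq_preConf_zero hS]
    refine ⟨QProtocol.isClear_pushState _ fun c _ => S.inClear_preConf t 0 x' c, ?_⟩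
    change (fun c => (S.protocol cap').compute (t * (S.slots + 3))
      ((S.protocol cap').run x' (t * (S.slots + 3))) (exchange c)) = _
    rw [hrun, compute_conf_zero hS hx, conf_zero_eq_preConf_zero hS, QProtocol.pushState_exchange]
    exact congrArg (fun Φ => pushState Φ _) (conf_zero_eq_preConf_zero hS t x')
  | succ m ih =>
    have ih := (ih (by omega)).2
    have hcomp := compute_conf hS ht (m := m) (by omega) x' hψ
    rw [ih, hcomp]
    refine ⟨QProtocol.isClear_pushState _ fun c _ => S.inClear_preConf t (m + 1) x' c, ?_⟩
    change (fun c => (S.protocol cap').compute (t * (S.slots + 3) + (m + 1))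
      ((S.protocol cap').run x' (t * (S.slots + 3) + (m + 1))) (exchange c)) = _
    rw [ih, hcomp, QProtocol.pushState_exchange]
    rfl

theorem run_eq_pushState (hS : S.Valid cap' T) {x' : Q → X'} {x : V → X}
    (hx : ∀ t ≤ T, ∀ v, S.inp v (x' (S.own t v)) = x v)
    (hclear : ∀ t < T, A.IsClear (A.compute t (A.run x t))) {t : ℕ} (ht : t ≤ T) :
    (S.protocol cap').run x' (t * (S.slots + 3)) =
      pushState (S.conf cap' t 0 x') (S.framedRun x t) := by
  induction t with
  | zero =>
    rw [Nat.zero_mul, framedRun_zero]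
    exact init_eq_pushState hS x'
  | succ t ih =>
    have hround := (run_round hS ht (hx t (by omega)) (hclear t ht) (ih (by omega))
      (m := S.slots + 2) (by omega)).2
    rw [Nat.succ_mul]
    refine hround.trans ?_
    rw [framedRun_succ]
    rw [pushState_congr (Ψ := fun c => S.conf cap' (t + 1) 0 x' (exchange c))
      fun c hc => conf_last hS t x' (S.inClear_of_framedCompute_ne_zero (hclear t ht) c hc)]
    let e : A.Basis ≃ A.Basis := ⟨exchange, exchange, fun _ => rfl, fun _ => rfl⟩
    exact pushState_comp_equiv (fun c => S.conf cap' (t + 1) 0 x' c)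
      (fun c => S.framedCompute x t (exchange c)) e

/-- The party `p` announces the answer of its reporter with the right probability. -/
theorem outputProb_protocol (hS : S.Valid cap' T) {x' : Q → X'} {x : V → X}
    (hx : ∀ t ≤ T, ∀ v, S.inp v (x' (S.own t v)) = x v)
    (hclear : ∀ t < T, A.IsClear (A.compute t (A.run x t)))
    {p : Q} (hp : S.own T (S.reporter p) = p) (b : Bool) :
    (S.protocol cap').outputProb x' (T * (S.slots + 3)) p b =
      A.outputProb x T (S.reporter p) b := by
  simp only [QProtocol.outputProb]
  rw [run_eq_pushState hS hx hclear le_rfl,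
    sum_pushState_of_injective (S.conf_zero_injective T x') _
      (fun c => (S.protocol cap').answer p (c p).1 = b)]
  refine Eq.trans ?_ (Equiv.sum_comp (S.frameAll x) _)
  refine Finset.sum_congr rfl fun c _ => ?_
  have : (S.protocol cap').answer p (S.conf cap' T 0 x' c p).1 =
      A.answer (S.reporter p) (S.frameAll x c (S.reporter p)).1 := by
    have hi := hx T le_rfl (S.reporter p)
    rw [hp] at hi
    change A.answer (S.reporter p) (S.frame (S.inp (S.reporter p) (x' p)) (S.reporter p)
      (S.hold T 0 p c (S.reporter p))).1 = _
    rw [hi]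
    simp only [hold, hp, if_true]
    rfl
  rw [this]
  rfl

/-- If every input of `P'` yields an input of `P` with the same answer that the owners of the
processors can compute, then the parties can solve `P'`. -/
theorem computes_protocol (hS : S.Valid cap' T) {P : PromiseProblem V X} {P' : PromiseProblem Q X'}
    {ε₀ ε₁ : ℝ} (hA : A.Computes P ε₀ ε₁ T) (hrep : ∀ p, S.own T (S.reporter p) = p)
    (hone : ∀ x', P'.isOne x' →
      ∃ x, P.isOne x ∧ ∀ t ≤ T, ∀ v, S.inp v (x' (S.own t v)) = x v)
    (hzero : ∀ x', P'.isZero x' →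
      ∃ x, P.isZero x ∧ ∀ t ≤ T, ∀ v, S.inp v (x' (S.own t v)) = x v) :
    (S.protocol cap').Computes P' ε₀ ε₁ (T * (S.slots + 3)) := by
  intro x' hx'
  refine ⟨?_, fun p hz => ?_, fun p ho => ?_⟩
  · obtain ⟨x, hxP, hx⟩ : ∃ x, (P.isOne x ∨ P.isZero x) ∧
        ∀ t ≤ T, ∀ v, S.inp v (x' (S.own t v)) = x v := by
      rcases hx' with h | h
      · obtain ⟨x, h1, h2⟩ := hone x' h
        exact ⟨x, .inl h1, h2⟩
      · obtain ⟨x, h1, h2⟩ := hzero x' h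
        exact ⟨x, .inr h1, h2⟩
    have hclear := (hA x hxP).1
    intro n hn
    have hdiv : n / (S.slots + 3) < T := Nat.div_lt_of_lt_mul (by rwa [mul_comm])
    have := (run_round hS hdiv (hx _ hdiv.le) (hclear _ hdiv)
      (run_eq_pushState hS hx hclear hdiv.le) (Nat.mod_lt n (Nat.succ_pos (S.slots + 2)))).1
    rwa [Nat.div_add_mod'] at this
  · obtain ⟨x, h1, hx⟩ := hzero x' hz
    have h := hA x (.inr h1)
    rw [outputProb_protocol hS hx h.1 (hrep p)]
    exact h.2.1 _ h1
  · obtain ⟨x, h1, hx⟩ := hone x' ho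
    have h := hA x (.inl h1)
    rw [outputProb_protocol hS hx h.1 (hrep p)]
    exact h.2.2 _ h1

end Schedule

/-! ### Hamiltonian cycles as connected 2-regular graphs -/

theorem isHamCycle_iff_connected_and_ncard_eq_two {V : Type} [Finite V] [DecidableEq V]
    {G : SimpleGraph V} :
    IsHamCycle G ↔ G.Connected ∧ ∀ v, (G.neighborSet v).ncard = 2 := by
  constructor
  · rintro ⟨a, p, hp, he⟩
    have hreach : ∀ v, G.Reachable a v := fun v => ⟨p.takeUntil v (hp.mem_support v)⟩
    refine ⟨(SimpleGraph.connected_iff _).2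
      ⟨fun u v => (hreach u).symm.trans (hreach v), ⟨a⟩⟩, fun v => ?_⟩
    rw [← hp.isCycle.ncard_neighborSet_toSubgraph_eq_two (hp.mem_support v)]
    congr 1
    ext w
    simp only [SimpleGraph.mem_neighborSet, SimpleGraph.Subgraph.mem_neighborSet,
      SimpleGraph.Walk.adj_toSubgraph_iff_mem_edges]
    exact ⟨fun h => he s(v, w) h, fun h => p.edges_subset_edgeSet h⟩
  · rintro ⟨hc, h2⟩
    obtain ⟨a⟩ := hc.nonempty
    have hne : (G.neighborSet a).Nonempty := by
      rw [← Set.ncard_pos, h2]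
      omega
    obtain ⟨p, hp, hverts⟩ :=
      SimpleGraph.IsCycles.exists_cycle_toSubgraph_verts_eq_connectedComponentSupp
        (c := G.connectedComponentMk a) (fun v _ => h2 v) rfl hne
    have hmem : ∀ v, v ∈ p.support := by
      intro v
      rw [← SimpleGraph.Walk.mem_verts_toSubgraph, hverts]
      exact SimpleGraph.ConnectedComponent.sound (hc.preconnected v a)
    refine ⟨a, p, ?_, ?_⟩
    · rw [SimpleGraph.Walk.isHamiltonianCycle_iff_isCycle_and_support_count_tail_eq_one]
      refine ⟨hp, fun v => List.count_eq_one_of_mem hp.support_nodup ?_⟩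
      by_cases hv : v = a
      · subst hv
        exact SimpleGraph.Walk.end_mem_tail_support hp.not_nil
      · have := hmem v
        rw [SimpleGraph.Walk.mem_support_iff] at this
        exact this.resolve_left hv
    · intro e
      induction e with
      | _ u v =>
      intro he
      rw [← SimpleGraph.Walk.adj_toSubgraph_iff_mem_edges]
      have hsub : p.toSubgraph.neighborSet u ⊆ G.neighborSet u :=
        p.toSubgraph.neighborSet_subset u
      have heq := Set.eq_of_subset_of_ncard_le hsub
        (by rw [h2, hp.ncard_neighborSet_toSubgraph_eq_two (hmem u)])
      exact heq.ge (show v ∈ G.neighborSet u from he)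

/-! ### Components and the number of edges that have to be added -/

/-- A connected graph has at least `c - 1` edges outside a graph with `c` components, since
contracting the components leaves a connected graph. -/
theorem card_connectedComponent_le_ncard_sdiff_add_one {V : Type} [Finite V]
    (M : SimpleGraph V) {M' : SimpleGraph V} (h : M'.Connected) :
    Nat.card M.ConnectedComponent ≤ (M'.edgeSet \ M.edgeSet).ncard + 1 := by
  let H : SimpleGraph M.ConnectedComponent :=
    { Adj := fun c d => c ≠ d ∧
        ∃ u v, M'.Adj u v ∧ M.connectedComponentMk u = c ∧ M.connectedComponentMk v = d
      symm := ⟨fun c d ⟨hne, u, v, huv, hu, hv⟩ => ⟨hne.symm, v, u, huv.symm, hv, hu⟩⟩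
      loopless := ⟨fun c hc => hc.1 rfl⟩ }
  have hreach : ∀ u v, M'.Reachable u v →
      H.Reachable (M.connectedComponentMk u) (M.connectedComponentMk v) := by
    rintro u v ⟨p⟩
    induction p with
    | nil => rfl
    | @cons a b c hab _ ih =>
      by_cases hne : M.connectedComponentMk a = M.connectedComponentMk b
      · rwa [hne]
      · exact (SimpleGraph.Adj.reachable (G := H) ⟨hne, a, b, hab, rfl, rfl⟩).trans ih
  have hH : H.Connected := by
    obtain ⟨a⟩ := h.nonempty
    refine (SimpleGraph.connected_iff _).2 ⟨fun c d => ?_, ⟨M.connectedComponentMk a⟩⟩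
    induction c using SimpleGraph.ConnectedComponent.ind with | _ u
    induction d using SimpleGraph.ConnectedComponent.ind with | _ v
    exact hreach u v (h.preconnected u v)
  have hsub : H.edgeSet ⊆ Sym2.map M.connectedComponentMk '' (M'.edgeSet \ M.edgeSet) := by
    intro e
    induction e with
    | _ c d =>
    rintro ⟨hne, u, v, huv, rfl, rfl⟩
    refine ⟨s(u, v), ⟨huv, fun hM => hne ?_⟩, rfl⟩
    exact SimpleGraph.ConnectedComponent.sound (SimpleGraph.Adj.reachable hM)
  have h1 := hH.card_vert_le_card_edgeSet_add_one
  have h2 := (Set.ncard_le_ncard hsub (Set.toFinite _)).trans (Set.ncard_image_le (Set.toFinite _))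
  rw [← Nat.card_coe_set_eq] at h2
  omega

/-- A Hamiltonian cycle has at least `c` edges outside a disconnected graph with `c` components:
it remains connected when one of them is deleted. -/
theorem card_connectedComponent_le_ncard_sdiff {V : Type} [Finite V] [DecidableEq V]
    {M M' : SimpleGraph V} (h : IsHamCycle M') (hM : ¬ M.Connected) :
    Nat.card M.ConnectedComponent ≤ (M'.edgeSet \ M.edgeSet).ncard := by
  have hconn := (isHamCycle_iff_connected_and_ncard_eq_two.1 h).1
  obtain ⟨e, he, heM⟩ : ∃ e, e ∈ M'.edgeSet ∧ e ∉ M.edgeSet := by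
    by_contra! hcon
    exact hM (hconn.mono (SimpleGraph.edgeSet_subset_edgeSet.1 hcon))
  obtain ⟨a, p, hp, hall⟩ := h
  induction e with
  | _ x y =>
  have hbr : ¬ M'.IsBridge s(x, y) := fun hb =>
    (SimpleGraph.isBridge_iff_forall_cycle_notMem he).1 hb p hp.isCycle (hall _ he)
  have h1 := card_connectedComponent_le_ncard_sdiff_add_one M
    (hconn.connected_delete_edge_of_not_isBridge hbr)
  have hss : (M'.deleteEdges {s(x, y)}).edgeSet \ M.edgeSet ⊂ M'.edgeSet \ M.edgeSet := by
    refine ⟨fun e he' => ?_, fun hcon => ?_⟩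
    · exact ⟨SimpleGraph.edgeSet_mono (SimpleGraph.deleteEdges_le _) he'.1, he'.2⟩
    · have := (hcon ⟨he, heM⟩).1
      simp at this
  have h2 := Set.ncard_lt_ncard hss (Set.toFinite _)
  omega

/-- A graph with `c` components becomes connected by adding `c - 1` edges. -/
theorem exists_connected_ncard_sdiff_add_one_le {V : Type} [Finite V] [Nonempty V]
    (G : SimpleGraph V) :
    ∃ G' : SimpleGraph V, G'.Connected ∧
      (G'.edgeSet \ G.edgeSet).ncard + 1 ≤ Nat.card G.ConnectedComponent := by
  classical
  obtain ⟨a⟩ := ‹Nonempty V›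
  let E : Set (Sym2 V) := (fun c : G.ConnectedComponent => s(a, c.out)) ''
    {c | c ≠ G.connectedComponentMk a}
  refine ⟨G ⊔ SimpleGraph.fromEdgeSet E, ?_, ?_⟩
  · have hreach : ∀ v, (G ⊔ SimpleGraph.fromEdgeSet E).Reachable a v := by
      intro v
      by_cases hv : G.connectedComponentMk v = G.connectedComponentMk a
      · exact (SimpleGraph.ConnectedComponent.exact hv).symm.mono le_sup_left
      · have h1 : G.Reachable (G.connectedComponentMk v).out v :=
          SimpleGraph.ConnectedComponent.exact (Quot.out_eq _)
        have hne : a ≠ (G.connectedComponentMk v).out := by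
          intro h
          rw [← h] at h1
          exact hv (SimpleGraph.ConnectedComponent.sound h1.symm)
        refine SimpleGraph.Reachable.trans (SimpleGraph.Adj.reachable ?_) (h1.mono le_sup_left)
        exact Or.inr ((SimpleGraph.fromEdgeSet_adj E).2 ⟨⟨_, hv, rfl⟩, hne⟩)
    exact (SimpleGraph.connected_iff _).2 ⟨fun u v => (hreach u).symm.trans (hreach v), ⟨a⟩⟩
  · have hsub : (G ⊔ SimpleGraph.fromEdgeSet E).edgeSet \ G.edgeSet ⊆ E := by
      rintro e ⟨he, heG⟩
      rw [SimpleGraph.edgeSet_sup, SimpleGraph.edgeSet_fromEdgeSet] at he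
      exact (he.resolve_left heG).1
    have h1 := (Set.ncard_le_ncard hsub (Set.toFinite _)).trans
      (Set.ncard_image_le (Set.toFinite _))
    have h2 : {c | c ≠ G.connectedComponentMk a}.ncard < Nat.card G.ConnectedComponent := by
      rw [← Set.ncard_univ]
      refine Set.ncard_lt_ncard ⟨Set.subset_univ _, fun h => ?_⟩ (Set.toFinite _)
      exact h (Set.mem_univ (G.connectedComponentMk a)) rfl
    omega

/-- If the vertices are arranged in a circle so that the steps outside `G` lead to a larger value
of `κ : V → Fin c`, except for the last step, then at most `c` edges of the circle are outside
`G`. -/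
theorem exists_isHamCycle_of_arrangement {V : Type} [Finite V] [DecidableEq V] (G : SimpleGraph V)
    {n c : ℕ} (e : Fin (n + 3) ≃ V) (κ : V → Fin c) (hκ : ∀ u v, G.Adj u v → κ u = κ v)
    (h : ∀ i : Fin (n + 2), G.Adj (e i.castSucc) (e i.succ) ∨ κ (e i.castSucc) < κ (e i.succ)) :
    ∃ G' : SimpleGraph V, IsHamCycle G' ∧ (G'.edgeSet \ G.edgeSet).ncard ≤ c := by
  let G' : SimpleGraph V := (SimpleGraph.cycleGraph (n + 3)).comap e.symm
  let iso : G' ≃g SimpleGraph.cycleGraph (n + 3) := ⟨e.symm, Iff.rfl⟩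
  refine ⟨G', isHamCycle_iff_connected_and_ncard_eq_two.2 ⟨?_, fun v => ?_⟩, ?_⟩
  · exact iso.connected_iff.2 SimpleGraph.cycleGraph_connected
  · have h1 : G'.neighborSet v =
        e '' (SimpleGraph.cycleGraph (n + 3)).neighborSet (e.symm v) := by
      ext w
      constructor
      · intro hw
        exact ⟨e.symm w, hw, by simp⟩
      · rintro ⟨i, hi, rfl⟩
        change (SimpleGraph.cycleGraph (n + 3)).Adj (e.symm v) (e.symm (e i))
        simpa using hi
    rw [h1, Set.ncard_image_of_injective _ e.injective, Set.ncard_eq_toFinset_card']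
    exact SimpleGraph.cycleGraph_degree_three_le
  · have hmono : Monotone (fun i => κ (e i)) := by
      rw [Fin.monotone_iff_le_succ]
      intro i
      rcases h i with h | h
      · exact (hκ _ _ h).le
      · exact h.le
    let B : Set (Fin (n + 3)) := {i | ¬ G.Adj (e i) (e (i + 1))}
    have hsub : G'.edgeSet \ G.edgeSet ⊆ (fun i => s(e i, e (i + 1))) '' B := by
      rintro x ⟨hx, hxG⟩
      induction x with
      | _ u v =>
      have hadj : (SimpleGraph.cycleGraph (n + 3)).Adj (e.symm u) (e.symm v) := hx
      rw [SimpleGraph.cycleGraph_adj] at hadj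
      rcases hadj with hadj | hadj
      · have hu : u = e (e.symm v + 1) := by
          rw [← hadj, add_sub_cancel, Equiv.apply_symm_apply]
        refine ⟨e.symm v, fun hG => hxG ?_, ?_⟩
        · rw [← hu, Equiv.apply_symm_apply] at hG
          exact hG.symm
        · simp only [← hu, Equiv.apply_symm_apply]
          exact Sym2.eq_swap
      · have hu : v = e (e.symm u + 1) := by
          rw [← hadj, add_sub_cancel, Equiv.apply_symm_apply]
        refine ⟨e.symm u, fun hG => hxG ?_, ?_⟩
        · rw [← hu, Equiv.apply_symm_apply] at hG
          exact hG
        · simp only [← hu, Equiv.apply_symm_apply]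
    have hlt : ∀ i ∈ B, ∀ j, i < j → κ (e i) < κ (e j) := by
      intro i hi j hij
      induction i using Fin.lastCases with
      | last => exact absurd hij (Fin.le_last j).not_gt
      | cast i =>
        have hb : ¬ G.Adj (e i.castSucc) (e i.succ) := by
          rw [← Fin.coeSucc_eq_succ]
          exact hi
        exact ((h i).resolve_left hb).trans_le (hmono (Fin.castSucc_lt_iff_succ_le.1 hij))
    have hinj : Set.InjOn (fun i => κ (e i)) B := by
      intro i hi j hj hij
      rcases lt_trichotomy i j with hlt' | heq | hlt'
      · exact absurd hij (hlt i hi j hlt').ne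
      · exact heq
      · exact absurd hij (hlt j hj i hlt').ne'
    calc (G'.edgeSet \ G.edgeSet).ncard
        ≤ B.ncard := (Set.ncard_le_ncard hsub (Set.toFinite _)).trans
          (Set.ncard_image_le (Set.toFinite _))
      _ = ((fun i => κ (e i)) '' B).ncard := hinj.ncard_image.symm
      _ ≤ (Set.univ : Set (Fin c)).ncard := Set.ncard_le_ncard (Set.subset_univ _)
      _ = c := by simp

/-- The cycles that form a 2-regular graph with `c` components can be cut open and joined to one
Hamiltonian cycle by `c` edges. -/
theorem exists_isHamCycle_ncard_sdiff_le {V : Type} [Fintype V] [Nonempty V] [DecidableEq V]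
    {G : SimpleGraph V} (h2 : ∀ v, (G.neighborSet v).ncard = 2) :
    ∃ G' : SimpleGraph V, IsHamCycle G' ∧
      (G'.edgeSet \ G.edgeSet).ncard ≤ Nat.card G.ConnectedComponent := by
  classical
  have hlist : ∀ c : G.ConnectedComponent, ∃ l : List V, l.Nodup ∧ l.IsChain G.Adj ∧
      l ≠ [] ∧ ∀ v, v ∈ l ↔ G.connectedComponentMk v = c := by
    intro c
    induction c using SimpleGraph.ConnectedComponent.ind with | _ a
    have hne : (G.neighborSet a).Nonempty := by
      rw [← Set.ncard_pos, h2]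
      omega
    obtain ⟨p, hp, hverts⟩ :=
      SimpleGraph.IsCycles.exists_cycle_toSubgraph_verts_eq_connectedComponentSupp
        (c := G.connectedComponentMk a) (fun v _ => h2 v) rfl hne
    have ha : a ∈ p.support.tail := SimpleGraph.Walk.end_mem_tail_support hp.not_nil
    refine ⟨p.support.tail, hp.support_nodup, p.isChain_adj_support.tail,
      List.ne_nil_of_mem ha, fun v => ?_⟩
    have : v ∈ p.support ↔ G.connectedComponentMk v = G.connectedComponentMk a := by
      rw [← SimpleGraph.Walk.mem_verts_toSubgraph, hverts]
      rfl
    rw [← this, SimpleGraph.Walk.mem_support_iff]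
    refine ⟨Or.inr, ?_⟩
    rintro (rfl | h)
    exacts [ha, h]
  choose l hnodup hchain hne hmem using hlist
  let c := Nat.card G.ConnectedComponent
  let ec : G.ConnectedComponent ≃ Fin c := Finite.equivFin _
  let κ : V → Fin c := fun v => ec (G.connectedComponentMk v)
  have hκ : ∀ u v, G.Adj u v → κ u = κ v := fun u v huv =>
    congrArg ec (SimpleGraph.ConnectedComponent.sound huv.reachable)
  have hκl : ∀ i v, v ∈ l (ec.symm i) → κ v = i := by
    intro i v hv
    change ec (G.connectedComponentMk v) = i
    rw [(hmem _ _).1 hv, Equiv.apply_symm_apply]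
  let L : List (List V) := List.ofFn fun i => l (ec.symm i)
  have hLnil : [] ∉ L := by
    intro h
    obtain ⟨i, hi⟩ := (List.mem_ofFn' _ _).1 h
    exact hne _ hi
  have hLchain : L.flatten.IsChain fun u v => G.Adj u v ∨ κ u < κ v := by
    rw [List.isChain_flatten hLnil]
    constructor
    · intro m hm
      obtain ⟨i, rfl⟩ := (List.mem_ofFn' _ _).1 hm
      exact (hchain _).imp fun _ _ => Or.inl
    · refine List.Pairwise.isChain (List.pairwise_ofFn.2 fun i j hij => ?_)
      intro x hx y hy
      rw [hκl i x (List.mem_of_mem_getLast? hx), hκl j y (List.mem_of_mem_head? hy)]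
      exact Or.inr hij
  have hLnodup : L.flatten.Nodup := by
    rw [List.nodup_flatten]
    constructor
    · intro m hm
      obtain ⟨i, rfl⟩ := (List.mem_ofFn' _ _).1 hm
      exact hnodup _
    · refine List.pairwise_ofFn.2 fun i j hij => ?_
      intro v hi hj
      exact hij.ne ((hκl i v hi).symm.trans (hκl j v hj))
  have hLmem : ∀ v, v ∈ L.flatten := by
    intro v
    refine List.mem_flatten.2 ⟨l (ec.symm (κ v)), (List.mem_ofFn' _ _).2 ⟨κ v, rfl⟩, ?_⟩
    rw [hmem]
    exact (ec.symm_apply_apply _).symm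
  let e : Fin L.flatten.length ≃ V := hLnodup.getEquivOfForallMemList _ hLmem
  have hcard : 3 ≤ L.flatten.length := by
    obtain ⟨a⟩ := ‹Nonempty V›
    have h1 : L.flatten.length = Nat.card V := by
      rw [← Nat.card_congr e, Nat.card_fin]
    have h3 : (insert a (G.neighborSet a)).ncard = 3 := by
      rw [Set.ncard_insert_of_notMem (by simp) (Set.toFinite _), h2]
    rw [h1, ← h3, ← Set.ncard_univ]
    exact Set.ncard_le_ncard (Set.subset_univ _) (Set.toFinite _)
  obtain ⟨n, hn⟩ : ∃ n, n + 3 = L.flatten.length := ⟨_, Nat.sub_add_cancel hcard⟩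
  refine exists_isHamCycle_of_arrangement G ((finCongr hn).trans e) κ hκ fun i => ?_
  have := hLchain.getElem i.val (by omega)
  exact this

/-! ### The network -/

/-- The shortcuts between columns: from `2 ^ i * y` to `2 ^ i * (y + 1)` for `y ≥ 1`. -/
def Shortcut (j j' : ℕ) : Prop :=
  ∃ i y, 1 ≤ y ∧ j = 2 ^ i * y ∧ j' = 2 ^ i * (y + 1)

section Network

variable {V : Type} {Γ m : ℕ} (e : V ≃ Fin Γ × Fin m)

/-- The network whose vertices are arranged in `Γ` lines with `m` columns.  Its edges join
neighbours on a line, vertices of a column to the vertex of the first line in this column, all pairs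
in the first column and all pairs in the last column, and the ends of shortcuts on the first
line. -/
def lineNetwork : SimpleGraph V :=
  SimpleGraph.fromRel fun v w =>
    ((e v).1 = (e w).1 ∧ ((e w).2 : ℕ) = (e v).2 + 1) ∨
    ((e v).2 = (e w).2 ∧ (((e w).1 : ℕ) = 0 ∨ ((e v).2 : ℕ) = 0 ∨ ((e v).2 : ℕ) + 1 = m)) ∨
    (((e v).1 : ℕ) = 0 ∧ ((e w).1 : ℕ) = 0 ∧ Shortcut (e v).2 (e w).2)

/-- The subgraph of the network that consists of all lines, a copy of `EC` in the first column
and a copy of `ED` in the last column.  It arises from `EC ⊔ ED` by replacing vertices by paths. -/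
def lineSubgraph (EC ED : SimpleGraph (Fin Γ)) : SimpleGraph V :=
  SimpleGraph.fromRel fun v w =>
    ((e v).1 = (e w).1 ∧ ((e w).2 : ℕ) = (e v).2 + 1) ∨
    (((e v).2 : ℕ) = 0 ∧ ((e w).2 : ℕ) = 0 ∧ EC.Adj (e v).1 (e w).1) ∨
    (((e v).2 : ℕ) + 1 = m ∧ ((e w).2 : ℕ) + 1 = m ∧ ED.Adj (e v).1 (e w).1)

variable {e} {EC ED : SimpleGraph (Fin Γ)}

theorem lineSubgraph_adj {v w : V} : (lineSubgraph e EC ED).Adj v w ↔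
    ((e v).1 = (e w).1 ∧ ((e w).2 : ℕ) = (e v).2 + 1) ∨
    ((e v).1 = (e w).1 ∧ ((e v).2 : ℕ) = (e w).2 + 1) ∨
    (((e v).2 : ℕ) = 0 ∧ ((e w).2 : ℕ) = 0 ∧ EC.Adj (e v).1 (e w).1) ∨
    (((e v).2 : ℕ) + 1 = m ∧ ((e w).2 : ℕ) + 1 = m ∧ ED.Adj (e v).1 (e w).1) := by
  rw [lineSubgraph, SimpleGraph.fromRel_adj]
  constructor
  · rintro ⟨-, (h | h | h) | (h | h | h)⟩
    · exact .inl h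
    · exact .inr (.inr (.inl h))
    · exact .inr (.inr (.inr h))
    · exact .inr (.inl ⟨h.1.symm, h.2⟩)
    · exact .inr (.inr (.inl ⟨h.2.1, h.1, h.2.2.symm⟩))
    · exact .inr (.inr (.inr ⟨h.2.1, h.1, h.2.2.symm⟩))
  · rintro (h | h | h | h)
    · refine ⟨?_, .inl (.inl h)⟩
      rintro rfl
      have := h.2
      omega
    · refine ⟨?_, .inr (.inl ⟨h.1.symm, h.2⟩)⟩
      rintro rfl
      have := h.2
      omega
    · refine ⟨?_, .inl (.inr (.inl h))⟩
      rintro rfl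
      exact h.2.2.ne rfl
    · refine ⟨?_, .inl (.inr (.inr h))⟩
      rintro rfl
      exact h.2.2.ne rfl

theorem lineSubgraph_le_lineNetwork : lineSubgraph e EC ED ≤ lineNetwork e := by
  intro v w h
  have hne := h.ne
  rw [lineSubgraph_adj] at h
  rw [lineNetwork, SimpleGraph.fromRel_adj]
  refine ⟨hne, ?_⟩
  rcases h with h | h | h | h
  · exact .inl (.inl h)
  · exact .inr (.inl ⟨h.1.symm, h.2⟩)
  · exact .inl (.inr (.inl ⟨Fin.ext (h.1.trans h.2.1.symm), .inr (.inl h.1)⟩))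
  · exact .inl (.inr (.inl ⟨Fin.ext (by omega), .inr (.inr h.1)⟩))

/-- The edges of the subgraph at a vertex outside the first (last) column do not depend on `EC`
(`ED`). -/
theorem nodeInput_lineSubgraph_congr {EC' ED' : SimpleGraph (Fin Γ)} {v : V}
    (hC : ((e v).2 : ℕ) = 0 → EC = EC') (hD : ((e v).2 : ℕ) + 1 = m → ED = ED') :
    nodeInput (lineSubgraph e EC ED) v = nodeInput (lineSubgraph e EC' ED') v := by
  funext w
  simp only [nodeInput, lineSubgraph_adj, decide_eq_decide]
  have h1 : (((e v).2 : ℕ) = 0 ∧ ((e w).2 : ℕ) = 0 ∧ EC.Adj (e v).1 (e w).1) ↔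
      (((e v).2 : ℕ) = 0 ∧ ((e w).2 : ℕ) = 0 ∧ EC'.Adj (e v).1 (e w).1) :=
    and_congr_right fun h => by rw [hC h]
  have h2 : (((e v).2 : ℕ) + 1 = m ∧ ((e w).2 : ℕ) + 1 = m ∧ ED.Adj (e v).1 (e w).1) ↔
      (((e v).2 : ℕ) + 1 = m ∧ ((e w).2 : ℕ) + 1 = m ∧ ED'.Adj (e v).1 (e w).1) :=
    and_congr_right fun h => by rw [hD h]
  rw [h1, h2]

/-! ### Contracting the lines -/

theorem reachable_of_lineSubgraph_reachable {v w : V} (h : (lineSubgraph e EC ED).Reachable v w) :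
    (EC ⊔ ED).Reachable (e v).1 (e w).1 := by
  obtain ⟨p⟩ := h
  induction p with
  | nil => rfl
  | @cons a b c hab _ ih =>
    refine SimpleGraph.Reachable.trans ?_ ih
    rcases lineSubgraph_adj.1 hab with h | h | h | h
    · rw [h.1]
    · rw [h.1]
    · exact SimpleGraph.Adj.reachable (Or.inl h.2.2)
    · exact SimpleGraph.Adj.reachable (Or.inr h.2.2)

theorem card_connectedComponent_sup_le [Finite V] (hm : 0 < m) :
    Nat.card (EC ⊔ ED).ConnectedComponent ≤
      Nat.card (lineSubgraph e EC ED).ConnectedComponent := by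
  let f : (lineSubgraph e EC ED).ConnectedComponent → (EC ⊔ ED).ConnectedComponent :=
    SimpleGraph.ConnectedComponent.lift (fun v => (EC ⊔ ED).connectedComponentMk (e v).1)
      fun v w p _ => SimpleGraph.ConnectedComponent.sound
        (reachable_of_lineSubgraph_reachable ⟨p⟩)
  refine Nat.card_le_card_of_surjective f fun c => ?_
  induction c using SimpleGraph.ConnectedComponent.ind with | _ u
  refine ⟨(lineSubgraph e EC ED).connectedComponentMk (e.symm (u, ⟨0, hm⟩)), ?_⟩
  simp [f]

theorem lineSubgraph_reachable_line (u : Fin Γ) (j j' : Fin m) :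
    (lineSubgraph e EC ED).Reachable (e.symm (u, j)) (e.symm (u, j')) := by
  have h0 : ∀ (k : ℕ) (hk : k < m), (lineSubgraph e EC ED).Reachable
      (e.symm (u, ⟨0, by omega⟩)) (e.symm (u, ⟨k, hk⟩)) := by
    intro k
    induction k with
    | zero => intro _; rfl
    | succ k ih =>
      intro hk
      refine (ih (by omega)).trans (SimpleGraph.Adj.reachable (lineSubgraph_adj.2 (.inl ?_)))
      simp
  exact (h0 j j.2).symm.trans (h0 j' j'.2)

theorem lineSubgraph_connected_iff (hm : 0 < m) :
    (lineSubgraph e EC ED).Connected ↔ (EC ⊔ ED).Connected := by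
  constructor
  · intro h
    obtain ⟨a⟩ := h.nonempty
    refine (SimpleGraph.connected_iff _).2 ⟨fun u v => ?_, ⟨(e a).1⟩⟩
    have := reachable_of_lineSubgraph_reachable
      (h.preconnected (e.symm (u, ⟨0, hm⟩)) (e.symm (v, ⟨0, hm⟩)))
    simpa using this
  · intro h
    obtain ⟨a⟩ := h.nonempty
    have key : ∀ u v, (EC ⊔ ED).Reachable u v → ∀ j j', (lineSubgraph e EC ED).Reachable
        (e.symm (u, j)) (e.symm (v, j')) := by
      rintro u v ⟨p⟩
      induction p with
      | nil => exact lineSubgraph_reachable_line _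
      | @cons a b c hab _ ih =>
        intro j j'
        rcases hab with hab | hab
        · refine (lineSubgraph_reachable_line a j ⟨0, hm⟩).trans
            (SimpleGraph.Reachable.trans (SimpleGraph.Adj.reachable ?_) (ih ⟨0, hm⟩ j'))
          exact lineSubgraph_adj.2 (.inr (.inr (.inl (by simpa using hab))))
        · refine (lineSubgraph_reachable_line a j ⟨m - 1, by omega⟩).trans
            (SimpleGraph.Reachable.trans (SimpleGraph.Adj.reachable ?_) (ih ⟨m - 1, by omega⟩ j'))
          refine lineSubgraph_adj.2 (.inr (.inr (.inr ?_)))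
          simp only [Equiv.apply_symm_apply]
          exact ⟨by omega, by omega, hab⟩
    refine (SimpleGraph.connected_iff _).2 ⟨fun v w => ?_, ⟨e.symm (a, ⟨0, hm⟩)⟩⟩
    have := key _ _ (h.preconnected (e v).1 (e w).1) (e v).2 (e w).2
    simpa using this

theorem existsUnique_adj_of_isPerfectMatching {α : Type*} {G : SimpleGraph α}
    (h : (⊤ : G.Subgraph).IsPerfectMatching) (u : α) : ∃ w, ∀ x, G.Adj u x ↔ x = w := by
  obtain ⟨w, hw, huniq⟩ := SimpleGraph.Subgraph.isPerfectMatching_iff.1 h u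
  refine ⟨w, fun x => ⟨fun hx => huniq x hx, ?_⟩⟩
  rintro rfl
  exact hw

theorem ncard_neighborSet_sup (hd : Disjoint EC ED) (hM : BothPerfectMatchings EC ED)
    (u : Fin Γ) : ((EC ⊔ ED).neighborSet u).ncard = 2 := by
  obtain ⟨c, hc⟩ := existsUnique_adj_of_isPerfectMatching hM.1 u
  obtain ⟨d, hD⟩ := existsUnique_adj_of_isPerfectMatching hM.2 u
  rw [Set.ncard_eq_two]
  refine ⟨c, d, ?_, ?_⟩
  · rintro rfl
    exact disjoint_iff_inf_le.1 hd ⟨(hc c).2 rfl, (hD c).2 rfl⟩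
  · ext w
    simp [hc, hD]

theorem ncard_neighborSet_lineSubgraph (hm : 2 ≤ m) (hM : BothPerfectMatchings EC ED) (v : V) :
    ((lineSubgraph e EC ED).neighborSet v).ncard = 2 := by
  obtain ⟨⟨u, j⟩, rfl⟩ := e.symm.surjective v
  obtain ⟨c, hc⟩ := existsUnique_adj_of_isPerfectMatching hM.1 u
  obtain ⟨d, hD⟩ := existsUnique_adj_of_isPerfectMatching hM.2 u
  rw [Set.ncard_eq_two]
  refine ⟨e.symm (if (j : ℕ) = 0 then (c, j) else (u, ⟨j - 1, by omega⟩)),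
    e.symm (if h : (j : ℕ) + 1 = m then (d, j) else (u, ⟨j + 1, by omega⟩)), ?_, ?_⟩
  · intro h
    have h' := congrArg (fun x : Fin Γ × Fin m => (x.2 : ℕ)) (e.symm.injective h)
    split_ifs at h' <;> simp at h' <;> omega
  · ext w
    obtain ⟨⟨u', j'⟩, rfl⟩ := e.symm.surjective w
    simp only [SimpleGraph.mem_neighborSet, lineSubgraph_adj, Equiv.apply_symm_apply, hc, hD,
      Set.mem_insert_iff, Set.mem_singleton_iff, EmbeddingLike.apply_eq_iff_eq]
    split_ifs <;> simp only [Prod.mk.injEq, Fin.ext_iff] <;> omega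

/-- Replacing vertices by paths preserves Hamiltonian cycles. -/
theorem isHamCycle_lineSubgraph_iff [Finite V] [DecidableEq V] (hm : 2 ≤ m) (hd : Disjoint EC ED)
    (hM : BothPerfectMatchings EC ED) :
    IsHamCycle (lineSubgraph e EC ED) ↔ IsHamCycle (EC ⊔ ED) := by
  rw [isHamCycle_iff_connected_and_ncard_eq_two, isHamCycle_iff_connected_and_ncard_eq_two,
    lineSubgraph_connected_iff (by omega)]
  exact and_congr_right fun _ => iff_of_true (ncard_neighborSet_lineSubgraph hm hM)
    (ncard_neighborSet_sup hd hM)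

theorem isFar_lineSubgraph_isHamCycle [Finite V] [DecidableEq V] [NeZero Γ] (hm : 2 ≤ m)
    (hd : Disjoint EC ED) (hM : BothPerfectMatchings EC ED) {δ : ℝ} (hn : ¬ IsHamCycle (EC ⊔ ED))
    (hfar : IsFar ⊤ IsHamCycle δ (EC ⊔ ED)) (host : SimpleGraph V) :
    IsFar host IsHamCycle δ (lineSubgraph e EC ED) := by
  intro M' _ hM'
  obtain ⟨G', hG', hcard⟩ := exists_isHamCycle_ncard_sdiff_le (ncard_neighborSet_sup hd hM)
  refine (hfar G' le_top hG').trans (Nat.cast_le.2 ?_)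
  have hconn : ¬ (lineSubgraph e EC ED).Connected := by
    rw [lineSubgraph_connected_iff (by omega)]
    exact fun h => hn (isHamCycle_iff_connected_and_ncard_eq_two.2
      ⟨h, ncard_neighborSet_sup hd hM⟩)
  exact (hcard.trans (card_connectedComponent_sup_le (by omega))).trans
    (card_connectedComponent_le_ncard_sdiff hM' hconn)

theorem isFar_lineSubgraph_connected [Finite V] [NeZero Γ] (hm : 0 < m) {δ : ℝ}
    (hfar : IsFar ⊤ SimpleGraph.Connected δ (EC ⊔ ED)) (host : SimpleGraph V) :
    IsFar host SimpleGraph.Connected δ (lineSubgraph e EC ED) := by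
  intro M' _ hM'
  obtain ⟨G', hG', hcard⟩ := exists_connected_ncard_sdiff_add_one_le (EC ⊔ ED)
  refine (hfar G' le_top hG').trans (Nat.cast_le.2 ?_)
  have h1 := card_connectedComponent_sup_le (e := e) (EC := EC) (ED := ED) hm
  have h2 := card_connectedComponent_le_ncard_sdiff_add_one (lineSubgraph e EC ED) hM'
  omega

/-! ### Cuts between columns -/

theorem Shortcut.lt {j j' : ℕ} (h : Shortcut j j') : j < j' := by
  obtain ⟨i, y, -, rfl, rfl⟩ := h
  exact Nat.mul_lt_mul_of_pos_left (Nat.lt_succ_self y) (by positivity)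

/-- A shortcut across the column `x` is determined by its length. -/
theorem Shortcut.eq_of_lt_of_lt {j j' x : ℕ} (h : Shortcut j j') (h1 : j < x) (h2 : x < j') :
    j = 2 ^ Nat.log 2 (j' - j) * (x / 2 ^ Nat.log 2 (j' - j)) ∧
      j' = j + 2 ^ Nat.log 2 (j' - j) := by
  obtain ⟨i, y, -, rfl, rfl⟩ := h
  have hsub : 2 ^ i * (y + 1) - 2 ^ i * y = 2 ^ i := by
    rw [mul_add, mul_one, Nat.add_sub_cancel_left]
  rw [hsub, Nat.log_pow (by norm_num)]
  refine ⟨?_, by ring⟩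
  have hy : x / 2 ^ i = y := by
    rw [Nat.div_eq_iff (by positivity)]
    constructor
    · rw [mul_comm]; exact h1.le
    · have : y * 2 ^ i + 2 ^ i = 2 ^ i * (y + 1) := by ring
      omega
  rw [hy]

theorem lineNetwork_adj_of_lt {v w : V} {x : ℕ} (h : (lineNetwork e).Adj v w)
    (h1 : ((e v).2 : ℕ) < x) (h2 : x < (e w).2) :
    ((e v).1 : ℕ) = 0 ∧ ((e w).1 : ℕ) = 0 ∧ Shortcut (e v).2 (e w).2 := by
  rw [lineNetwork, SimpleGraph.fromRel_adj] at h
  rcases h with ⟨-, (h | h | h) | (h | h | h)⟩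
  · have := h.2
    omega
  · have := Fin.ext_iff.1 h.1
    omega
  · exact h
  · have := h.2
    omega
  · have := Fin.ext_iff.1 h.1
    omega
  · have := h.2.2.lt
    omega

/-- The edges of the network across a column have different lengths, even after rounding to powers
of `2`. -/
theorem eq_of_lineNetwork_adj_of_lt {v w v' w' : V} {x : ℕ} (h : (lineNetwork e).Adj v w)
    (h1 : ((e v).2 : ℕ) < x) (h2 : x < (e w).2) (h' : (lineNetwork e).Adj v' w')
    (h1' : ((e v').2 : ℕ) < x) (h2' : x < (e w').2)
    (hlog : Nat.log 2 ((e w').2 - (e v').2) = Nat.log 2 ((e w).2 - (e v).2)) :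
    v' = v ∧ w' = w := by
  obtain ⟨hv, hw, hs⟩ := lineNetwork_adj_of_lt h h1 h2
  obtain ⟨hv', hw', hs'⟩ := lineNetwork_adj_of_lt h' h1' h2'
  obtain ⟨a, b⟩ := hs.eq_of_lt_of_lt h1 h2
  obtain ⟨a', b'⟩ := hs'.eq_of_lt_of_lt h1' h2'
  rw [hlog] at a' b'
  have hcol : ((e v').2 : ℕ) = (e v).2 := a'.trans a.symm
  refine ⟨e.injective (Prod.ext (Fin.ext (hv'.trans hv.symm)) (Fin.ext hcol)),
    e.injective (Prod.ext (Fin.ext (hw'.trans hw.symm)) (Fin.ext ?_))⟩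
  exact (b'.trans (by rw [hcol])).trans b.symm

/-! ### The diameter of the network -/

/-- Going along an edge at most doubles the distance from the left end. -/
theorem lineNetwork_adj_le {v w : V} (h : (lineNetwork e).Adj v w) :
    ((e w).2 : ℕ) + 1 ≤ 2 * ((e v).2 + 1) := by
  rw [lineNetwork, SimpleGraph.fromRel_adj] at h
  rcases h with ⟨-, (h | h | ⟨-, -, h⟩) | (h | h | ⟨-, -, h⟩)⟩
  · have := h.2
    omega
  · have := Fin.ext_iff.1 h.1
    omega
  · obtain ⟨i, y, hy, h1, h2⟩ := h
    have : 2 ^ i * 1 ≤ 2 ^ i * y := Nat.mul_le_mul_left _ hy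
    rw [h1, h2, mul_add]
    omega
  · have := h.2
    omega
  · have := Fin.ext_iff.1 h.1
    omega
  · have := h.lt
    omega

theorem log_le_log_add_length {v w : V} (p : (lineNetwork e).Walk v w) :
    Nat.log 2 ((e w).2 + 1) ≤ Nat.log 2 ((e v).2 + 1) + p.length := by
  induction p with
  | nil => simp
  | @cons a b c hab p ih =>
    have h1 : Nat.log 2 ((e b).2 + 1) ≤ Nat.log 2 (((e a).2 + 1) * 2) :=
      Nat.log_mono_right ((lineNetwork_adj_le hab).trans (mul_comm _ _).le)
    rw [Nat.log_mul_base (by norm_num) (by omega)] at h1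
    rw [SimpleGraph.Walk.length_cons]
    omega

theorem lineNetwork_adj_next (u : Fin Γ) {j : ℕ} (hj : j + 1 < m) :
    (lineNetwork e).Adj (e.symm (u, ⟨j, by omega⟩)) (e.symm (u, ⟨j + 1, hj⟩)) := by
  rw [lineNetwork, SimpleGraph.fromRel_adj]
  refine ⟨fun h => ?_, .inl (.inl (by simp))⟩
  have := congrArg (fun x : Fin Γ × Fin m => (x.2 : ℕ)) (e.symm.injective h)
  simp at this

theorem lineNetwork_adj_shortcut [NeZero Γ] {j j' : ℕ} (h : Shortcut j j') (hj' : j' < m) :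
    (lineNetwork e).Adj (e.symm (0, ⟨j, h.lt.trans hj'⟩)) (e.symm (0, ⟨j', hj'⟩)) := by
  rw [lineNetwork, SimpleGraph.fromRel_adj]
  refine ⟨fun h' => ?_, .inl (.inr (.inr (by simpa using h)))⟩
  have := congrArg (fun x : Fin Γ × Fin m => (x.2 : ℕ)) (e.symm.injective h')
  exact h.lt.ne this

/-- Repeatedly halving an even column number, or decreasing an odd one, leads to column `1` along
shortcuts. -/
theorem exists_walk_length_le [NeZero Γ] (hm : 1 < m) (z i : ℕ) (hz : 1 ≤ z) (h : 2 ^ i * z < m) :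
    ∃ p : (lineNetwork e).Walk (e.symm (0, ⟨2 ^ i * z, h⟩)) (e.symm (0, ⟨1, hm⟩)),
      p.length ≤ 2 * Nat.log 2 z + i := by
  induction z using Nat.strong_induction_on generalizing i with
  | _ z ih =>
  rcases hz.eq_or_lt with rfl | hz'
  · induction i with
    | zero => exact ⟨SimpleGraph.Walk.nil.copy rfl (by simp), by simp⟩
    | succ i ih' =>
      have h2 : 2 ^ i * 2 < m := by rw [← pow_succ]; simpa using h
      obtain ⟨p, hp⟩ := ih' (by omega)
      have hadj := lineNetwork_adj_shortcut (e := e) (Γ := Γ) (j := 2 ^ i * 1) (j' := 2 ^ i * 2)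
        ⟨i, 1, le_rfl, rfl, rfl⟩ h2
      have heq : 2 ^ i * 2 = 2 ^ (i + 1) * 1 := by ring
      refine ⟨(SimpleGraph.Walk.cons hadj.symm p).copy (by simp only [heq]) rfl, ?_⟩
      simp only [SimpleGraph.Walk.length_copy, SimpleGraph.Walk.length_cons]
      omega
  · have hlog : Nat.log 2 z = Nat.log 2 (z / 2) + 1 := Nat.log_of_one_lt_of_le (by norm_num) hz'
    rcases Nat.even_or_odd' z with ⟨y, hy | hy⟩
    · have heq : 2 ^ (i + 1) * y = 2 ^ i * z := by rw [hy]; ring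
      obtain ⟨p, hp⟩ := ih y (by omega) (i + 1) (by omega) (by omega)
      refine ⟨p.copy (by simp only [heq]) rfl, ?_⟩
      rw [hlog, show z / 2 = y by omega]
      simp only [SimpleGraph.Walk.length_copy]
      omega
    · have heq : 2 ^ i * z = 2 ^ i * (2 * y + 1) := by rw [hy]
      have heq' : 2 ^ (i + 1) * y = 2 ^ i * (2 * y) := by ring
      have hs : Shortcut (2 ^ (i + 1) * y) (2 ^ i * z) :=
        ⟨i, 2 * y, by omega, heq', heq⟩
      obtain ⟨p, hp⟩ := ih y (by omega) (i + 1) (by omega) (hs.lt.trans h)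
      refine ⟨SimpleGraph.Walk.cons (lineNetwork_adj_shortcut hs h).symm p, ?_⟩
      rw [hlog, show z / 2 = y by omega]
      simp only [SimpleGraph.Walk.length_cons]
      omega

theorem exists_walk_to_center [NeZero Γ] {k : ℕ} (hk : 1 ≤ k) (hmk : m = 2 ^ k) (hm : 1 < m)
    (v : V) : ∃ p : (lineNetwork e).Walk v (e.symm (0, ⟨1, hm⟩)), p.length ≤ 2 * k + 1 := by
  obtain ⟨⟨u, j⟩, rfl⟩ := e.symm.surjective v
  have hline : ∃ p : (lineNetwork e).Walk (e.symm (0, j)) (e.symm (0, ⟨1, hm⟩)),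
      p.length ≤ 2 * k := by
    rcases Nat.eq_zero_or_pos (j : ℕ) with hj | hj
    · have hadj := lineNetwork_adj_next (e := e) 0 (j := 0) hm
      have : j = ⟨0, by omega⟩ := Fin.ext hj
      refine ⟨hadj.toWalk.copy (congrArg (fun x => e.symm (0, x)) this.symm) rfl, ?_⟩
      simp only [SimpleGraph.Walk.length_copy, SimpleGraph.Walk.length_cons,
        SimpleGraph.Walk.length_nil]
      omega
    · obtain ⟨p, hp⟩ := exists_walk_length_le (e := e) hm j 0 hj (by simp)
      have hlog : Nat.log 2 j < k := Nat.log_lt_of_lt_pow hj.ne' (hmk ▸ j.2)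
      refine ⟨p.copy (by simp) rfl, ?_⟩
      simp only [SimpleGraph.Walk.length_copy]
      omega
  obtain ⟨p, hp⟩ := hline
  by_cases hu : u = 0
  · subst hu
    exact ⟨p, by omega⟩
  · have hadj : (lineNetwork e).Adj (e.symm (u, j)) (e.symm (0, j)) := by
      rw [lineNetwork, SimpleGraph.fromRel_adj]
      refine ⟨fun h => hu ?_, .inl (.inr (.inl (by simp)))⟩
      exact congrArg Prod.fst (e.symm.injective h)
    refine ⟨SimpleGraph.Walk.cons hadj p, ?_⟩
    simp only [SimpleGraph.Walk.length_cons]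
    omega

theorem lineNetwork_connected_and_diam [NeZero Γ] [Finite V] {k : ℕ} (hk : 1 ≤ k)
    (hmk : m = 2 ^ k) :
    (lineNetwork e).Connected ∧ k ≤ (lineNetwork e).diam ∧ (lineNetwork e).diam ≤ 4 * k + 2 := by
  have hm : 1 < m := hmk ▸ Nat.one_lt_two_pow (by omega)
  have hcenter := exists_walk_to_center (e := e) hk hmk hm
  have hwalk : ∀ v w, ∃ p : (lineNetwork e).Walk v w, p.length ≤ 4 * k + 2 := by
    intro v w
    obtain ⟨p, hp⟩ := hcenter v
    obtain ⟨q, hq⟩ := hcenter w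
    refine ⟨p.append q.reverse, ?_⟩
    rw [SimpleGraph.Walk.length_append, SimpleGraph.Walk.length_reverse]
    omega
  have : Nonempty V := ⟨e.symm (0, ⟨1, hm⟩)⟩
  have hconn : (lineNetwork e).Connected :=
    (SimpleGraph.connected_iff _).2 ⟨fun v w => ⟨(hwalk v w).choose⟩, this⟩
  refine ⟨hconn, ?_, ?_⟩
  · have htop := SimpleGraph.connected_iff_ediam_ne_top.1 hconn
    obtain ⟨p, hp⟩ := hconn.exists_walk_length_eq_dist (e.symm (0, ⟨0, by omega⟩))
      (e.symm (0, ⟨m - 1, by omega⟩))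
    have h1 := log_le_log_add_length p
    have h2 := SimpleGraph.dist_le_diam htop (u := e.symm (0, ⟨0, by omega⟩))
      (v := e.symm (0, ⟨m - 1, by omega⟩))
    simp only [Equiv.apply_symm_apply, zero_add, Nat.log_one_right, hp] at h1
    have hlog : Nat.log 2 m = k := by rw [hmk, Nat.log_pow (by norm_num)]
    rw [Nat.sub_add_cancel hm.le, hlog] at h1
    exact h1.trans h2
  · obtain ⟨v, w, hvw⟩ := (lineNetwork e).exists_dist_eq_diam
    obtain ⟨p, hp⟩ := hwalk v w
    rw [← hvw]
    exact (SimpleGraph.dist_le p).trans hp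

end Network

/-! ### The parties' schedule -/

/-- In round `t` of the simulation Carol owns the first `t + 1` columns, David owns the last `t + 1`
columns, and the server owns the others. -/
def columnOwner (m t j : ℕ) : Party :=
  if j ≤ t then .carol else if m ≤ j + t + 1 then .david else .server

theorem columnOwner_eq_carol_iff {m t j : ℕ} : columnOwner m t j = .carol ↔ j ≤ t := by
  unfold columnOwner
  split_ifs <;> simp_all

theorem columnOwner_eq_david_iff {m t j : ℕ} :
    columnOwner m t j = .david ↔ t < j ∧ m ≤ j + t + 1 := by
  unfold columnOwner
  split_ifs <;> simp_all

theorem columnOwner_eq_server_iff {m t j : ℕ} :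
    columnOwner m t j = .server ↔ t < j ∧ j + t + 1 < m := by
  unfold columnOwner
  split_ifs <;> simp_all

theorem serverModel_server {p : Party} (h : p ≠ .server) : serverModel .server p = ⊤ := by
  cases p
  · rfl
  · rfl
  · exact absurd rfl h

theorem one_le_serverModel {p p' : Party} (h : p ≠ p') : 1 ≤ serverModel p p' := by
  cases p <;> cases p' <;> simp_all [serverModel]

section

variable {V : Type} {N : SimpleGraph V} {B K : ℕ} {u v : V}

theorem adj_of_fin_numQubits (i : Fin (numQubits K (bModel N B u v))) : N.Adj u v := by
  by_contra h
  have := i.2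
  simp [numQubits, bModel, h] at this

theorem fin_numQubits_lt (i : Fin (numQubits K (bModel N B u v))) : (i : ℕ) < B := by
  have h := adj_of_fin_numQubits i
  have := i.2
  simpa [numQubits, bModel, h] using this

end

section Simulation

variable {V : Type} [Fintype V] [DecidableEq V] {Γ k : ℕ} [NeZero Γ] (e : V ≃ Fin Γ × Fin (2 ^ k))
  {B : ℕ} (A : QProtocol V (bModel (lineNetwork e) B) (V → Bool))

/-- The schedule by which the three parties simulate a protocol on the network for `T` rounds.  A
message that crosses about `2 ^ i` columns is sent in the `i`-th group of `B` time slots. -/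
noncomputable def lineSchedule (T : ℕ) (hT : T + 1 < 2 ^ k) (w₀ : (v : V) → A.Anc v) :
    Schedule A Party (SimpleGraph (Fin Γ)) where
  own t v := columnOwner (2 ^ k) t (e v).2
  inp v g := nodeInput (lineSubgraph e g g) v
  slots := k * B
  slot _ u v i := Nat.log 2 ((e u).2 - (e v).2 + ((e v).2 - (e u).2)) * B + i
  x₀ := fun _ => false
  w₀ := w₀
  reporter
    | .carol => e.symm (0, ⟨0, by omega⟩)
    | .david => e.symm (0, ⟨2 ^ k - 1, by omega⟩)
    | .server => e.symm (0, ⟨T + 1, hT⟩)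

variable {e A}

theorem lineSchedule_valid {T : ℕ} (hT : 2 * T + 4 ≤ 2 ^ k) (hk : 1 ≤ k) (hB : 1 ≤ B)
    (w₀ : (v : V) → A.Anc v) :
    (lineSchedule e A T (by omega) w₀).Valid serverModel T where
  slots_pos := Nat.mul_pos hk hB
  slot_lt := by
    intro t u v i
    have h1 : Nat.log 2 ((e u).2 - (e v).2 + ((e v).2 - (e u).2)) < k := by
      have hu := (e u).2.2
      have hv := (e v).2.2
      rcases Nat.eq_zero_or_pos ((e u).2 - (e v).2 + ((e v).2 - (e u).2) : ℕ) with h | h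
      · rw [h, Nat.log_zero_right]
        exact hk
      · exact Nat.log_lt_of_lt_pow h.ne' (by omega)
    calc Nat.log 2 ((e u).2 - (e v).2 + ((e v).2 - (e u).2)) * B + i
        < Nat.log 2 ((e u).2 - (e v).2 + ((e v).2 - (e u).2)) * B + B :=
          Nat.add_lt_add_left (fin_numQubits_lt i) _
      _ = (Nat.log 2 ((e u).2 - (e v).2 + ((e v).2 - (e u).2)) + 1) * B := by ring
      _ ≤ k * B := Nat.mul_le_mul_right B h1
  one_le p p' h := one_le_serverModel h
  own_change := by
    intro t ht v hv
    change columnOwner _ _ _ ≠ columnOwner _ _ _ at hv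
    change serverModel (columnOwner _ _ _) (columnOwner _ _ _) = ⊤
    have hs : columnOwner (2 ^ k) t (e v).2 = .server := by
      rw [columnOwner_eq_server_iff]
      by_contra hcon
      refine hv ?_
      rcases le_or_gt ((e v).2 : ℕ) t with h | h
      · rw [columnOwner_eq_carol_iff.2 h, columnOwner_eq_carol_iff.2 (by omega)]
      · rw [columnOwner_eq_david_iff.2 (by omega), columnOwner_eq_david_iff.2 (by omega)]
    rw [hs] at hv ⊢
    exact serverModel_server hv.symm
  slot_inj := by
    intro t ht u v i u' v' i' hne hcap hu hv hslot
    change columnOwner _ _ _ ≠ columnOwner _ _ _ at hne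
    change serverModel (columnOwner _ _ _) (columnOwner _ _ _) ≠ ⊤ at hcap
    change columnOwner _ _ _ = columnOwner _ _ _ at hu hv
    change Nat.log 2 _ * B + (i' : ℕ) = Nat.log 2 _ * B + (i : ℕ) at hslot
    have hi := fin_numQubits_lt i
    have hi' := fin_numQubits_lt i'
    have hlog := congrArg (· / B) hslot
    have hbit := congrArg (· % B) hslot
    simp only [Nat.mul_add_mod', Nat.mod_eq_of_lt hi, Nat.mod_eq_of_lt hi'] at hbit
    simp only [mul_comm _ B, Nat.mul_add_div hB, Nat.div_eq_of_lt hi, Nat.div_eq_of_lt hi',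
      add_zero] at hlog
    have hadj := adj_of_fin_numQubits i
    have hadj' := adj_of_fin_numQubits i'
    have huv : u' = u ∧ v' = v := by
      -- A message leaves Carol's (David's) part across the column `t + 1` (`2 ^ k - (t + 2)`).
      cases hc : columnOwner (2 ^ k) t (e u).2 with
      | carol =>
        rw [hc] at hu hne
        have h1 := columnOwner_eq_carol_iff.1 hc
        have h1' := columnOwner_eq_carol_iff.1 hu
        have h2 := mt columnOwner_eq_carol_iff.2 hne.symm
        have h2' := mt columnOwner_eq_carol_iff.2 (hv ▸ hne.symm)
        refine eq_of_lineNetwork_adj_of_lt (x := t + 1) hadj (by omega) (by omega) hadj'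
          (by omega) (by omega) ?_
        convert hlog using 2 <;> omega
      | david =>
        rw [hc] at hu hne
        have h1 := columnOwner_eq_david_iff.1 hc
        have h1' := columnOwner_eq_david_iff.1 hu
        have h2 := mt columnOwner_eq_david_iff.2 hne.symm
        have h2' := mt columnOwner_eq_david_iff.2 (hv ▸ hne.symm)
        refine (eq_of_lineNetwork_adj_of_lt (x := 2 ^ k - (t + 2)) hadj.symm (by omega) (by omega)
          hadj'.symm (by omega) (by omega) ?_).symm
        convert hlog using 2 <;> omega
      | server =>
        rw [hc] at hcap hne
        exact absurd (serverModel_server hne.symm) hcap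
    obtain ⟨rfl, rfl⟩ := huv
    rw [Fin.ext hbit]

theorem lineSchedule_own_reporter {T : ℕ} (hT : 2 * T + 4 ≤ 2 ^ k) (w₀ : (v : V) → A.Anc v)
    (p : Party) :
    (lineSchedule e A T (by omega) w₀).own T ((lineSchedule e A T (by omega) w₀).reporter p) =
      p := by
  cases p
  · simp [lineSchedule, columnOwner_eq_carol_iff]
  · simp only [lineSchedule, columnOwner_eq_david_iff, Equiv.apply_symm_apply]
    omega
  · simp only [lineSchedule, columnOwner_eq_server_iff, Equiv.apply_symm_apply]
    omega

/-- The owner of a vertex knows the edges of the subgraph at this vertex. -/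
theorem lineSchedule_inp {T : ℕ} (hT : 2 * T + 4 ≤ 2 ^ k) (w₀ : (v : V) → A.Anc v)
    (EC ED : SimpleGraph (Fin Γ)) (t : ℕ) (ht : t ≤ T) (v : V) :
    (lineSchedule e A T (by omega) w₀).inp v
      (partyInput EC ED ((lineSchedule e A T (by omega) w₀).own t v)) =
      nodeInput (lineSubgraph e EC ED) v := by
  change nodeInput (lineSubgraph e (partyInput EC ED (columnOwner _ _ _))
    (partyInput EC ED (columnOwner _ _ _))) v = _
  cases hc : columnOwner (2 ^ k) t (e v).2 with
  | carol =>
    rw [columnOwner_eq_carol_iff] at hc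
    exact nodeInput_lineSubgraph_congr (fun _ => rfl) (fun h => by omega)
  | david =>
    rw [columnOwner_eq_david_iff] at hc
    exact nodeInput_lineSubgraph_congr (fun h => by omega) (fun _ => rfl)
  | server =>
    rw [columnOwner_eq_server_iff] at hc
    exact nodeInput_lineSubgraph_congr (fun h => by omega) (fun h => by omega)

end Simulation

/-! ### Complexities -/

theorem QProtocol.Computes.quantumComplexity_le {V : Type} [Fintype V] [DecidableEq V]
    {cap : V → V → ℕ∞} {X : Type} [Fintype X] [DecidableEq X] {P : PromiseProblem V X}
    {ε₀ ε₁ : ℝ} {A : QProtocol V cap X} {T : ℕ} (h : A.Computes P ε₀ ε₁ T) :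
    quantumComplexity cap P ε₀ ε₁ ≤ T :=
  iInf₂_le T ⟨A, h⟩

theorem exists_computes_of_quantumComplexity_eq {V : Type} [Fintype V] [DecidableEq V]
    {cap : V → V → ℕ∞} {X : Type} [Fintype X] [DecidableEq X] {P : PromiseProblem V X}
    {ε₀ ε₁ : ℝ} {T : ℕ} (h : quantumComplexity cap P ε₀ ε₁ = T) :
    ∃ A : QProtocol V cap X, A.Computes P ε₀ ε₁ T := by
  have hlt : quantumComplexity cap P ε₀ ε₁ < ((T + 1 : ℕ) : ℕ∞) := by
    rw [h]
    exact_mod_cast Nat.lt_succ_self T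
  obtain ⟨T', hT'⟩ := iInf_lt_iff.1 hlt
  obtain ⟨⟨A, hA⟩, hlt'⟩ := iInf_lt_iff.1 hT'
  have h1 : T' < T + 1 := by exact_mod_cast hlt'
  have h2 : (T : ℕ∞) ≤ T' := h ▸ hA.quantumComplexity_le
  have h3 : T ≤ T' := by exact_mod_cast h2
  obtain rfl : T' = T := by omega
  exact ⟨A, hA⟩

/-- The simulation for problems that are related by `lineSubgraph`. -/
theorem simulationBound_lineNetwork {n Γ k B L : ℕ} [NeZero Γ] (e : Fin n ≃ Fin Γ × Fin (2 ^ k))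
    (hk : 1 ≤ k) (hB : 1 ≤ B) (hL : 2 ≤ L) (hLk : L ≤ 2 ^ k) (hkL : (k : ℝ) ≤ 2 * Real.logb 2 L)
    {ε₀ ε₁ : ℝ} {P : PromiseProblem (Fin n) (Fin n → Bool)}
    {P' : PromiseProblem Party (SimpleGraph (Fin Γ))}
    (hone : ∀ x', P'.isOne x' → ∃ EC ED, x' = partyInput EC ED ∧
      P.isOne (nodeInput (lineSubgraph e EC ED)))
    (hzero : ∀ x', P'.isZero x' → ∃ EC ED, x' = partyInput EC ED ∧
      P.isZero (nodeInput (lineSubgraph e EC ED))) :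
    SimulationBound 5 B L ε₀ ε₁ (lineNetwork e) P P' := by
  intro T hT hTL
  obtain ⟨A, hA⟩ := exists_computes_of_quantumComplexity_eq hT
  have hT4 : 2 * T + 4 ≤ 2 ^ k := by
    have : (2 * T + 4 : ℝ) ≤ L := by linarith
    exact (show 2 * T + 4 ≤ L by exact_mod_cast this).trans hLk
  obtain ⟨w₀⟩ : Nonempty ((v : Fin n) → A.Anc v) := by
    by_contra h
    rw [not_nonempty_iff] at h
    have := A.ent_unit
    simp at this
  have hcomp := Schedule.computes_protocol (S := lineSchedule e A T (by omega) w₀)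
    (lineSchedule_valid hT4 hk hB w₀) hA (lineSchedule_own_reporter hT4 w₀) (P' := P')
    (by
      intro x' hx'
      obtain ⟨EC, ED, rfl, h⟩ := hone x' hx'
      exact ⟨_, h, fun t ht v => lineSchedule_inp hT4 w₀ EC ED t ht v⟩)
    (by
      intro x' hx'
      obtain ⟨EC, ED, rfl, h⟩ := hzero x' hx'
      exact ⟨_, h, fun t ht v => lineSchedule_inp hT4 w₀ EC ED t ht v⟩)
  have hle : quantumComplexity serverModel P' ε₀ ε₁ ≤ ((T * (k * B + 3) : ℕ) : ℕ∞) :=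
    hcomp.quantumComplexity_le
  obtain ⟨S, hS⟩ := ENat.ne_top_iff_exists.1 (ne_top_of_le_ne_top (ENat.natCast_ne_top _) hle)
  refine ⟨S, hS.symm, ?_⟩
  rw [← hS] at hle
  have hST : (S : ℝ) ≤ T * (k * B + 3) := by exact_mod_cast hle
  have hlog : 1 ≤ Real.logb 2 L := by
    rw [Real.le_logb_iff_rpow_le (by norm_num) (by positivity)]
    simpa using hL
  have hB' : (1 : ℝ) ≤ B := by exact_mod_cast hB
  have hprod : 1 ≤ B * Real.logb 2 L := by nlinarith
  have hkB : (k : ℝ) * B ≤ 2 * (B * Real.logb 2 L) := by nlinarith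
  calc (S : ℝ) ≤ T * (k * B + 3) := hST
    _ ≤ T * (5 * (B * Real.logb 2 L)) :=
      mul_le_mul_of_nonneg_left (by linarith) (Nat.cast_nonneg T)
    _ = 5 * (B * Real.logb 2 L) * T := by ring

theorem mainTheorem6 :
    ∃ c₁ c₂ C : ℝ, 0 < c₁ ∧ 0 < c₂ ∧ 0 < C ∧
      ∀ (B L Γ : ℕ) (β ε₀ ε₁ : ℝ), 1 ≤ B → 2 ≤ L → Real.logb 2 L ≤ Γ →
        0 ≤ β → 0 ≤ ε₀ → 0 ≤ ε₁ →
        ∃ (n : ℕ) (N : SimpleGraph (Fin n)),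
          N.Connected ∧
          c₁ * ((Γ : ℝ) * L) ≤ n ∧ (n : ℝ) ≤ c₂ * ((Γ : ℝ) * L) ∧
          c₁ * Real.logb 2 L ≤ N.diam ∧ (N.diam : ℝ) ≤ c₂ * Real.logb 2 L ∧
          SimulationBound C B L ε₀ ε₁ N (gapHamNetwork N (β * Γ)) (gapHamServer Γ (β * Γ)) ∧
          SimulationBound C B L ε₀ ε₁ N (hamNetwork N) (hamServer Γ) ∧
          SimulationBound C B L ε₀ ε₁ N (gapConnNetwork N (β * Γ)) (gapConnServer Γ (β * Γ)) := by
  refine ⟨1, 10, 5, by norm_num, by norm_num, by norm_num, ?_⟩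
  intro B L Γ β ε₀ ε₁ hB hL hΓ _ _ _
  have hlog : 1 ≤ Real.logb 2 L := by
    rw [Real.le_logb_iff_rpow_le (by norm_num) (by positivity)]
    simpa using hL
  have hΓ0 : Γ ≠ 0 := by
    rintro rfl
    norm_num at hΓ
    linarith
  have : NeZero Γ := ⟨hΓ0⟩
  -- The number of columns is the least power of two that is at least `L`.
  let k := Nat.clog 2 L
  have hLk : L ≤ 2 ^ k := Nat.le_pow_clog (by norm_num) L
  have hk : 1 ≤ k := Nat.clog_pos (by norm_num) hL
  have hkL' : 2 ^ (k - 1) < L := Nat.pow_pred_clog_lt_self (by norm_num) hL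
  have hLpos : (0 : ℝ) < L := by positivity
  have hlogk : Real.logb 2 L ≤ k := by
    rw [Real.logb_le_iff_le_rpow (by norm_num) hLpos, Real.rpow_natCast]
    exact_mod_cast hLk
  have hklog : (k : ℝ) ≤ Real.logb 2 L + 1 := by
    have h1 : ((k - 1 : ℕ) : ℝ) ≤ Real.logb 2 L := by
      rw [Real.le_logb_iff_rpow_le (by norm_num) hLpos, Real.rpow_natCast]
      exact_mod_cast hkL'.le
    rw [Nat.cast_sub hk, Nat.cast_one] at h1
    linarith
  have h2k : 2 ^ k ≤ 2 * L := by
    have : 2 ^ k = 2 * 2 ^ (k - 1) := by rw [← pow_succ', Nat.sub_add_cancel hk]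
    omega
  have h2m : 2 ≤ 2 ^ k := hL.trans hLk
  let e : Fin (Γ * 2 ^ k) ≃ Fin Γ × Fin (2 ^ k) := finProdFinEquiv.symm
  obtain ⟨hconn, hdiam1, hdiam2⟩ := lineNetwork_connected_and_diam (e := e) hk rfl
  have hdiam1' : (k : ℝ) ≤ (lineNetwork e).diam := by exact_mod_cast hdiam1
  have hdiam2' : ((lineNetwork e).diam : ℝ) ≤ 4 * k + 2 := by exact_mod_cast hdiam2
  have hLk' : (L : ℝ) ≤ 2 ^ k := by exact_mod_cast hLk
  have h2k' : (2 ^ k : ℝ) ≤ 2 * L := by exact_mod_cast h2k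
  refine ⟨Γ * 2 ^ k, lineNetwork e, hconn, ?_, ?_, by linarith, by linarith, ?_, ?_, ?_⟩
  · push_cast
    rw [one_mul]
    exact mul_le_mul_of_nonneg_left hLk' (Nat.cast_nonneg Γ)
  · push_cast
    have := mul_le_mul_of_nonneg_left h2k' (Nat.cast_nonneg (α := ℝ) Γ)
    have h0 : 0 ≤ (Γ : ℝ) * L := by positivity
    linarith
  · refine simulationBound_lineNetwork e hk hB hL hLk (by linarith) ?_ ?_
    · rintro _ ⟨EC, ED, hd, hM, rfl, h⟩
      exact ⟨EC, ED, rfl, _, lineSubgraph_le_lineNetwork, rfl,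
        (isHamCycle_lineSubgraph_iff h2m hd hM).2 h⟩
    · rintro _ ⟨EC, ED, hd, hM, rfl, h, hfar⟩
      exact ⟨EC, ED, rfl, _, lineSubgraph_le_lineNetwork, rfl,
        mt (isHamCycle_lineSubgraph_iff h2m hd hM).1 h,
        isFar_lineSubgraph_isHamCycle h2m hd hM h hfar _⟩
  · refine simulationBound_lineNetwork e hk hB hL hLk (by linarith) ?_ ?_
    · rintro _ ⟨EC, ED, hd, hM, rfl, h⟩
      exact ⟨EC, ED, rfl, _, lineSubgraph_le_lineNetwork, rfl,
        (isHamCycle_lineSubgraph_iff h2m hd hM).2 h⟩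
    · rintro _ ⟨EC, ED, hd, hM, rfl, h⟩
      exact ⟨EC, ED, rfl, _, lineSubgraph_le_lineNetwork, rfl,
        mt (isHamCycle_lineSubgraph_iff h2m hd hM).1 h⟩
  · refine simulationBound_lineNetwork e hk hB hL hLk (by linarith) ?_ ?_
    · rintro _ ⟨EC, ED, -, -, rfl, h⟩
      exact ⟨EC, ED, rfl, _, lineSubgraph_le_lineNetwork, rfl,
        (lineSubgraph_connected_iff (by omega)).2 h⟩
    · rintro _ ⟨EC, ED, -, -, rfl, h, hfar⟩
      exact ⟨EC, ED, rfl, _, lineSubgraph_le_lineNetwork, rfl,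
        mt (lineSubgraph_connected_iff (by omega)).1 h,
        isFar_lineSubgraph_connected (by omega) hfar _⟩
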